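/- Let $a,b\in\mathbb R$ and $H\in\mathbb R\setminus\{0\}$, and let $$\xi(\lambda)=i\begin{pmatrix}0&a\lambda^{-1}+b\lambda\\ b\lambda^{-1}+a\lambda&0\end{pmatrix},\qquad \lambda\in S^1,$$ so that $\xi\,dz$ is a potential in normal form. For $\lambda=e^{it}$ write $'=\partial/\partial t$. Let $\tau=\mathrm{Ad}\,\mathrm{diag}(1,-1)$ and call a loop $g$ on $S^1$ twisted if $g(-\lambda)=\tau g(\lambda)$. Let $F_\lambda:\mathbb C\to\Lambda \mathrm{SU}(2)_\tau$ be the extended frame generated by $\xi\,dz$: for every $z\in\mathbb C$, $\exp(z\,\xi(\lambda))=F_\lambda(z)\,B_\lambda(z)$ on $S^1$, where $\lambda\mapsto F_\lambda(z)$ is a smooth twisted loop in $\mathrm{SU}(2)$ and $\lambda\mapsto B_\lambda(z)$ is a smooth twisted loop in $\mathrm{SL}(2,\mathbb C)$ that extends continuously to $|\lambda|\le1$ and holomorphically to $|\lambda|<1$, with value at $\lambda=0$ of the form $\mathrm{diag}(r,1/r)$, $r>0$ (Iwasawa decomposition). Identify $\mathfrak{su}(2)$ with Euclidean $\mathbb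 R^3$ by $\langle X,Y\rangle=-2\,\mathrm{tr}(XY)$, oriented so that the Lie bracket is the cross product, and put $\mathrm e_1=\tfrac12\mathrm{diag}(i,-i)$. For $\lambda\in S^1$ let $$f^{\pm}_\lambda=-\frac1{2H}\left(F_\lambda(\mp \mathrm e_1)F_\lambda^{-1}+F_\lambda'F_\lambda^{-1}\right)$$ be the parallel surfaces given by the Sym--Bobenko formula. For a map $f$ of the $z=x+iy$-plane into $\mathbb R^3$ let $N=f_x\times f_y/|f_x\times f_y|$, let the Hopf differential be $\langle f_{zz},N\rangle dz^2$, and let the mean curvature be half the trace of the second fundamental form $\langle D^2 f,N\rangle$ with respect to the induced metric. Let $\mathrm{dn}(u\,|\,m)$ denote the Jacobi elliptic function with parameter $m$ (real $u$, $m\le1$), and set $$Q=2abH^{-1},\qquad v_0(y)=2bH^{-1}\,\mathrm{dn}\left(2by\,\middle|\,1-a^2/b^2\right)\quad(b\ne0).$$ Then for every $\lambda\in S^1$: if $b\neq0$, $f_\lambda=f^+_\lambda$ is a smooth conformal immersion $\mathbb C\to\mathbb R^3$ of constant mean curvature $H$, with Hopf differential $\lambda^{-2}Q\,dz^2$ and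 metric $v_0(y)^2\,dz\otimes d\bar z$ (that is, $v_0^2(dx^2+dy^2)$). If $a\ne0$, the parallel surface $f^-_\lambda$ is also a smooth conformal immersion of constant mean curvature $H$ with Hopf differential $\lambda^{-2}Q\,dz^2$, and its metric is given by the same formula with $a$ and $b$ interchanged, $v_0$ being replaced by $2aH^{-1}\,\mathrm{dn}(2ay\,|\,1-b^2/a^2)$. -/

import Mathlib

open scoped ContDiff Matrix

noncomputable section

namespace EquivariantCMC

/-- Complex `2 × 2` matrices; `SU(2)`, `SL(2, ℂ)` and their Lie algebras live here. -/
abbrev Mat2 : Type := Matrix (Fin 2) (Fin 2) ℂ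

/-- A (matrix valued) loop, a function on the unit circle. -/
abbrev MatLoop : Type := Circle → Mat2

/-! ### The twisted loop groups -/

/-- Smoothness of a loop, in the angular coordinate `t`, `λ = exp (i t)`. -/
def SmoothLoop (g : MatLoop) : Prop :=
  ∀ i j, ContDiff ℝ ∞ (fun t : ℝ => g (Circle.exp t) i j)

/-- The involution `τ = Ad diag(1, -1)`; on `SU(2)` its fixed set is the group of diagonal
matrices, and `SU(2) / (SU(2))^τ` is the `2`-sphere. -/
def tau (X : Mat2) : Mat2 := !![1, 0; 0, -1] * X * !![1, 0; 0, -1]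

/-- Twisted loops: `g (ω λ) = τ (g λ)` with `ω = exp (2 π i / 2) = -1`. -/
def TwistedLoop (g : MatLoop) : Prop :=
  ∀ μ : Circle, g (Circle.exp Real.pi * μ) = tau (g μ)

/-- The loop group `Λ SU(2)_τ`. -/
structure IsUnitaryLoop (g : MatLoop) : Prop where
  smooth : SmoothLoop g
  twisted : TwistedLoop g
  mem : ∀ μ, g μ ∈ Matrix.specialUnitaryGroup (Fin 2) ℂ

/-- The loop group `Λ₊ SL(2, ℂ)_τ`: smooth twisted loops in `SL(2, ℂ)` that extend holomorphically
to the open unit disc (and continuously to the closed one), with value at `0` in the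
group `B` of the matrices `diag(r, 1 / r)`, `r > 0`. Here `K^ℂ = K B` is the Iwasawa decomposition
of the complex diagonal group, `K` being the unitary diagonal group. -/
structure IsPositiveLoop (g : MatLoop) : Prop where
  smooth : SmoothLoop g
  twisted : TwistedLoop g
  det_eq_one : ∀ μ, (g μ).det = 1
  extends_disc : ∃ h : ℂ → Mat2,
    (∀ i j, DiffContOnCl ℂ (fun w => h w i j) (Metric.ball 0 1)) ∧
    (∀ μ : Circle, h (μ : ℂ) = g μ) ∧
    ∃ r : ℝ, 0 < r ∧ h 0 = !![(r : ℂ), 0; 0, (r : ℂ)⁻¹]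

/-- `F : ℂ → Λ SU(2)_τ` is the extended frame generated by the constant potential `ξ dz`:
`exp (z ξ) = F z · B z` is the Iwasawa decomposition of `exp (z ξ)`, for every `z`. -/
def IsExtendedFrame (ξ : MatLoop) (F : ℂ → MatLoop) : Prop :=
  ∀ z : ℂ, IsUnitaryLoop (F z) ∧
    ∃ B : MatLoop, IsPositiveLoop B ∧
      ∀ μ : Circle, NormedSpace.exp (z • ξ μ) = F z μ * B μ

/-- The coefficient `ξ` of the potential `ξ dz` in normal form with constants `a`, `b`. -/
def normalForm (a b : ℝ) : MatLoop := fun μ =>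
  Complex.I • !![0, a * (μ : ℂ)⁻¹ + b * (μ : ℂ); b * (μ : ℂ)⁻¹ + a * (μ : ℂ), 0]

/-! ### The Sym--Bobenko formula -/

/-- The derivative of a loop at `μ` with respect to `t`, where `λ = exp (i t)`. -/
def loopDeriv (g : MatLoop) (μ : Circle) : Mat2 :=
  Matrix.of fun i j => deriv (fun t : ℝ => g (Circle.exp t * μ) i j) 0

/-- The unit vector `e₁ = ½ diag(i, -i)` of `su(2)`. -/
def e1 : Mat2 := !![Complex.I / 2, 0; 0, -(Complex.I / 2)]

/-- The homomorphism `Φ_μ(g) = (g, g' g⁻¹)|_μ` into `SU(2) ⋉ su(2)`, followed by the affine action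
`(g, ζ) · η = Ad g η + ζ` on `η ∈ su(2)`. -/
def euclideanAction (g : MatLoop) (μ : Circle) (η : Mat2) : Mat2 :=
  g μ * η * (g μ)⁻¹ + loopDeriv g μ * (g μ)⁻¹

/-- Coordinates `su(2) ≅ ℝ³` with respect to the basis `½ diag(i, -i)`, `½ [[0, i], [i, 0]]`,
`½ [[0, -1], [1, 0]]`. It is orthonormal for `⟨X, Y⟩ = -2 tr (X Y)`, and it turns the Lie bracket
into the cross product (`toR3_dotProduct` and `toR3_bracket` below). -/
def toR3 (X : Mat2) : Fin 3 → ℝ := ![2 * (X 0 0).im, 2 * (X 1 0).im, 2 * (X 1 0).re]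

/-- The Sym--Bobenko formula `-(1 / (2 H)) Φ_μ(F) · (-s e₁)`: the surface `f⁺_μ` for `s = 1`, and
its parallel surface `f⁻_μ` for `s = -1`. -/
def symBobenko (H s : ℝ) (F : ℂ → MatLoop) (μ : Circle) (z : ℂ) : Fin 3 → ℝ :=
  toR3 ((-(1 / (2 * H))) • euclideanAction (F z) μ ((-s) • e1))

theorem toR3_dotProduct (X Y : Mat2) (hX : Xᴴ = -X) (hY : Yᴴ = -Y) (tX : X.trace = 0)
    (tY : Y.trace = 0) : ((toR3 X ⬝ᵥ toR3 Y : ℝ) : ℂ) = -2 * (X * Y).trace := by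
  have a1 := congrFun (congrFun hX 0) 0
  have a2 := congrFun (congrFun hX 0) 1
  have b1 := congrFun (congrFun hY 0) 0
  have b2 := congrFun (congrFun hY 0) 1
  simp only [Matrix.conjTranspose_apply, Matrix.neg_apply, Matrix.trace_fin_two] at *
  rw [Complex.ext_iff] at a1 a2 b1 b2 tX tY
  simp at a1 a2 b1 b2 tX tY
  apply Complex.ext <;> simp [toR3, Matrix.mul_apply, Fin.sum_univ_two, Fin.sum_univ_three,
    dotProduct] <;> grind

theorem toR3_bracket (X Y : Mat2) (hX : Xᴴ = -X) (hY : Yᴴ = -Y) (tX : X.trace = 0)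
    (tY : Y.trace = 0) : toR3 (X * Y - Y * X) = toR3 X ⨯₃ toR3 Y := by
  have a1 := congrFun (congrFun hX 0) 0
  have a2 := congrFun (congrFun hX 0) 1
  have b1 := congrFun (congrFun hY 0) 0
  have b2 := congrFun (congrFun hY 0) 1
  simp only [Matrix.conjTranspose_apply, Matrix.neg_apply, Matrix.trace_fin_two] at *
  rw [Complex.ext_iff] at a1 a2 b1 b2 tX tY
  simp at a1 a2 b1 b2 tX tY
  rw [cross_apply]
  ext i
  fin_cases i <;> simp [toR3, Matrix.mul_apply, Fin.sum_univ_two] <;> grind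

/-! ### Surfaces in Euclidean `3`-space, parametrised by `z = x + i y`

For `ℝ³ = (Fin 3 → ℝ)` the Euclidean inner product is the dot product `⬝ᵥ`. -/

/-- The derivative of `f` in the direction `u`; `u = 1` gives `f_x`, `u = i` gives `f_y`. -/
def dirDeriv (f : ℂ → Fin 3 → ℝ) (u z : ℂ) : Fin 3 → ℝ := fderiv ℝ f z u

/-- The first fundamental form (induced metric) at `z`. -/
def firstForm (f : ℂ → Fin 3 → ℝ) (z u w : ℂ) : ℝ := dirDeriv f u z ⬝ᵥ dirDeriv f w z

/-- The unit normal `N = (f_x × f_y) / |f_x × f_y|`. -/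
def unitNormal (f : ℂ → Fin 3 → ℝ) (z : ℂ) : Fin 3 → ℝ :=
  let n := dirDeriv f 1 z ⨯₃ dirDeriv f Complex.I z
  (Real.sqrt (n ⬝ᵥ n))⁻¹ • n

/-- The second fundamental form `⟨D_u D_w f, N⟩` at `z`. -/
def secondForm (f : ℂ → Fin 3 → ℝ) (z u w : ℂ) : ℝ :=
  dirDeriv (dirDeriv f w) u z ⬝ᵥ unitNormal f z

/-- The mean curvature, half the trace of the second fundamental form with respect to the first. -/
def meanCurvature (f : ℂ → Fin 3 → ℝ) (z : ℂ) : ℝ :=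
  (secondForm f z 1 1 * firstForm f z Complex.I Complex.I
      - 2 * (secondForm f z 1 Complex.I * firstForm f z 1 Complex.I)
      + secondForm f z Complex.I Complex.I * firstForm f z 1 1) /
    (2 * (firstForm f z 1 1 * firstForm f z Complex.I Complex.I - firstForm f z 1 Complex.I ^ 2))

/-- The coefficient `⟨f_zz, N⟩` of the Hopf differential `⟨f_zz, N⟩ dz²`, where
`f_zz = ¼ (f_xx - f_yy - 2 i f_xy)`. -/
def hopfCoeff (f : ℂ → Fin 3 → ℝ) (z : ℂ) : ℂ :=
  (((secondForm f z 1 1 - secondForm f z Complex.I Complex.I : ℝ) : ℂ)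
      - 2 * Complex.I * ((secondForm f z 1 Complex.I : ℝ) : ℂ)) / 4

/-- `f` is a smooth immersion of the plane with induced metric `v² dz ⊗ dz̄` (that is,
`v² (dx² + dy²)`), constant mean curvature `H`, and Hopf differential `q dz²`. -/
structure HasSurfaceInvariants (f : ℂ → Fin 3 → ℝ) (v : ℂ → ℝ) (H : ℝ) (q : ℂ) : Prop where
  smooth : ContDiff ℝ ∞ f
  immersion : ∀ z, Function.Injective (fderiv ℝ f z)
  metric : ∀ z u w, firstForm f z u w = v z ^ 2 * (u * (starRingEnd ℂ) w).re
  mean_curvature : ∀ z, meanCurvature f z = H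
  hopf : ∀ z, hopfCoeff f z = q

/-! ### The Jacobi elliptic function `dn` -/

/-- The incomplete elliptic integral of the first kind, `∫₀^φ dθ / √(1 - m sin² θ)`. -/
def ellipticF (m φ : ℝ) : ℝ := ∫ θ in (0 : ℝ)..φ, 1 / Real.sqrt (1 - m * Real.sin θ ^ 2)

/-- The interval of amplitudes around `0` on which the integrand of `ellipticF m` is finite: it is
`ℝ` for `m < 1`, and `(-π/2, π/2)` for `m = 1`. -/
def amplitudeDomain (m : ℝ) : Set ℝ := {φ | ∀ θ ∈ Set.uIcc 0 φ, m * Real.sin θ ^ 2 < 1}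

/-- The Jacobi amplitude `am(u | m)` for real `u` and real parameter `m ≤ 1`: the inverse function
of the bijection `ellipticF m` from `amplitudeDomain m` onto `ℝ`. -/
def jacobiAm (u m : ℝ) : ℝ := Function.invFunOn (ellipticF m) (amplitudeDomain m) u

/-- The Jacobi elliptic function `dn(u | m) = √(1 - m sin² am(u | m))` for real `u` and real
parameter `m ≤ 1`. -/
def jacobiDn (u m : ℝ) : ℝ := Real.sqrt (1 - m * Real.sin (jacobiAm u m) ^ 2)

/-- `v₀(y) = 2 b H⁻¹ dn(2 b y | 1 - a² / b²)`, meaningful for `b ≠ 0`. -/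
def v0 (a b H y : ℝ) : ℝ := 2 * b * H⁻¹ * jacobiDn (2 * b * y) (1 - a ^ 2 / b ^ 2)

end EquivariantCMC

end

/-! Since `ξ` is constant in `z`, a real translation multiplies `exp(zξ)` on the left by a unitary
loop, so the positive Iwasawa factor depends only on `y = Im z`. Thus `F = exp(zξ) R(y)`, where `R`
is the inverse of that factor. Put `U = R⁻¹ξR`. If `R' = -RW`, then `F⁻¹dF = U dx + (iU - W) dy`.
Taking for `W` the part of `iU` that is holomorphic in `λ` makes `V = iU - W` skew-Hermitian, and
`U' = [W, U]` becomes the Lax system for `p, q, r`. It conserves `qr = ab` and `p² + q² + r² = a² +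
b²`, whence `r'² = -4(r² - a²)(r² - b²)`, an equation solved by `r(y) = b dn(2by | 1 - a²/b²)`.

The proof runs this backwards. `exists_isLaxSolution` supplies the `dn` solution,
`exists_positiveFactor` integrates it to an `R` entire in `λ`, the product `exp(zξ) R` is unitary on
the circle, and `iwasawa_unique` identifies it with the given `F`.

Differentiating the Sym–Bobenko formula then gives `f_x = v F A F*` and `f_y = v F B F*`, with `A,
B` orthonormal and independent of `z`, and `v = 2r/H` for `f⁺`, `v = 2q/H` for `f⁻`. The second
fundamental form is read off from commutators with `U` and `V` (`hasSurfaceInvariants_of_isFrame`).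
Its trace yields `H`, and `qr = ab` makes the Hopf differential constant. The symmetry `(p, q, r) ↦
(-p, r, q)` exchanges `a` and `b` and covers `f⁻`. -/

noncomputable section

namespace EquivariantCMC

/-! ### Linear equations `C' = λ C K` solved by power series in `λ` -/

section LinearODE

open scoped Nat

variable {A : Type*} [NormedRing A] [NormedAlgebra ℂ A]

/-- The iterated integrals `c₀ = 1`, `cₙ₊₁(y) = ∫₀^y cₙ K`. -/
def iterInt (K : ℝ → A) : ℕ → ℝ → A
  | 0, _ => 1
  | n + 1, y => ∫ s in (0 : ℝ)..y, iterInt K n s * K s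

theorem continuous_iterInt {K : ℝ → A} (hK : Continuous K) (n : ℕ) :
    Continuous (iterInt K n) := by
  induction n with
  | zero => exact continuous_const
  | succ n ih =>
    exact intervalIntegral.continuous_primitive
      (fun a b => (ih.mul hK).intervalIntegrable a b) 0

theorem hasDerivAt_iterInt_succ [CompleteSpace A] {K : ℝ → A} (hK : Continuous K) (n : ℕ) (y : ℝ) :
    HasDerivAt (iterInt K (n + 1)) (iterInt K n y * K y) y :=
  intervalIntegral.integral_hasDerivAt_right
    (((continuous_iterInt hK n).mul hK).intervalIntegrable _ _)
    (((continuous_iterInt hK n).mul hK).stronglyMeasurableAtFilter _ _)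
    ((continuous_iterInt hK n).mul hK).continuousAt

theorem iterInt_succ_zero (K : ℝ → A) (n : ℕ) : iterInt K (n + 1) 0 = 0 := by
  simp [iterInt]

/-- Each integration contributes the factor `M|y|/(n + 1)`, so the factorial survives the induction.
The factor `‖1‖` stays because the unit of `A` is not assumed to have norm one. -/
theorem norm_iterInt_le {K : ℝ → A} {M ρ : ℝ} (hM : 0 ≤ M)
    (hKM : ∀ y, |y| ≤ ρ → ‖K y‖ ≤ M) (n : ℕ) (y : ℝ) (hy : |y| ≤ ρ) :
    ‖iterInt K n y‖ ≤ ‖(1 : A)‖ * ((M * |y|) ^ n / n !) := by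
  induction n generalizing y with
  | zero => simp [iterInt]
  | succ n ih =>
    have key : ∀ u : ℝ, 0 ≤ u →
        ∫ s in (0 : ℝ)..u, ‖(1 : A)‖ * ((M * s) ^ n / n !) * M
          = ‖(1 : A)‖ * ((M * u) ^ (n + 1) / (n + 1)!) := by
      intro u hu
      have : ∀ s : ℝ, ‖(1 : A)‖ * ((M * s) ^ n / n !) * M
          = (‖(1 : A)‖ * M ^ (n + 1) / n !) * s ^ n := by
        intro s; rw [mul_pow]; ring
      simp_rw [this]
      rw [intervalIntegral.integral_const_mul, integral_pow, Nat.factorial_succ]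
      have := Nat.factorial_ne_zero n
      push_cast
      field_simp
      ring
    have bound : ∀ s : ℝ, |s| ≤ ρ →
        ‖iterInt K n s * K s‖ ≤ ‖(1 : A)‖ * ((M * |s|) ^ n / n !) * M := by
      intro s hs
      refine (norm_mul_le _ _).trans ?_
      exact mul_le_mul (ih s hs) (hKM s hs) (norm_nonneg _) (by positivity)
    have hcont : Continuous fun s : ℝ => ‖(1 : A)‖ * ((M * |s|) ^ n / n !) * M := by fun_prop
    rw [iterInt]
    rcases le_total 0 y with h | h
    · rw [abs_of_nonneg h, ← key y h]
      rw [abs_of_nonneg h] at hy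
      have : ∫ s in (0 : ℝ)..y, ‖(1 : A)‖ * ((M * s) ^ n / n !) * M
          = ∫ s in (0 : ℝ)..y, ‖(1 : A)‖ * ((M * |s|) ^ n / n !) * M := by
        refine intervalIntegral.integral_congr fun s hs => ?_
        rw [Set.uIcc_of_le h] at hs
        simp only [abs_of_nonneg hs.1]
      rw [this]
      refine intervalIntegral.norm_integral_le_of_norm_le h ?_ (hcont.intervalIntegrable _ _)
      refine Filter.Eventually.of_forall fun s hs => bound s ?_
      rw [abs_of_pos hs.1]; exact hs.2.trans hy
    · rw [abs_of_nonpos h, ← key (-y) (by linarith)]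
      rw [abs_of_nonpos h] at hy
      have : ∫ s in (0 : ℝ)..(-y), ‖(1 : A)‖ * ((M * s) ^ n / n !) * M
          = ∫ s in y..(0 : ℝ), ‖(1 : A)‖ * ((M * |s|) ^ n / n !) * M := by
        have h1 := intervalIntegral.integral_comp_neg (a := y) (b := 0)
          (fun s : ℝ => ‖(1 : A)‖ * ((M * s) ^ n / n !) * M)
        rw [neg_zero] at h1
        rw [← h1]
        refine intervalIntegral.integral_congr fun s hs => ?_
        rw [Set.uIcc_of_le h] at hs
        simp only [abs_of_nonpos hs.2]
      rw [this, intervalIntegral.integral_symm, norm_neg]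
      refine intervalIntegral.norm_integral_le_of_norm_le h ?_ (hcont.intervalIntegrable _ _)
      refine Filter.Eventually.of_forall fun s hs => bound s ?_
      rw [abs_of_nonpos hs.2]; linarith [hs.1]

/-- On bounded intervals the iterated integrals are dominated by an exponential series. -/
theorem exists_iterInt_bound {K : ℝ → A} (hK : Continuous K) (ρ : ℝ) :
    ∃ c x k : ℝ, 0 ≤ c ∧ 0 ≤ x ∧ 0 ≤ k ∧ (∀ y, |y| < ρ → ‖K y‖ ≤ k) ∧
      ∀ n y, |y| < ρ → ‖iterInt K n y‖ ≤ c * (x ^ n / n !) := by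
  obtain ⟨M, hM⟩ := (isCompact_Icc (a := -ρ) (b := ρ)).exists_bound_of_continuousOn
    hK.continuousOn
  have hM' : ∀ y, |y| ≤ ρ → ‖K y‖ ≤ max M 0 := fun y hy =>
    (hM y (abs_le.mp hy)).trans (le_max_left _ _)
  refine ⟨‖(1 : A)‖, max M 0 * max ρ 0, max M 0, norm_nonneg _, by positivity, le_max_right _ _,
    fun y hy => hM' y hy.le, fun n y hy => ?_⟩
  refine (norm_iterInt_le (le_max_right M 0) hM' n y hy.le).trans ?_
  have : |y| ≤ max ρ 0 := hy.le.trans (le_max_left _ _)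
  gcongr

/-- Dominates the series differentiated in `λ`: the weight `n + 1 ≤ 2ⁿ` is absorbed by doubling `x`.
-/
theorem summable_succ_mul_pow_div_factorial (x : ℝ) (hx : 0 ≤ x) :
    Summable fun n : ℕ => ((n : ℝ) + 1) * (x ^ n / n !) := by
  refine Summable.of_nonneg_of_le (fun n => by positivity) (fun n => ?_)
    (Real.summable_pow_div_factorial (2 * x))
  have h : (n : ℝ) + 1 ≤ 2 ^ n := by exact_mod_cast Nat.lt_two_pow_self (n := n)
  rw [mul_pow, mul_div_assoc]
  gcongr

/-- The solution `Σ λⁿ cₙ(y)` of `C' = λ C K`. -/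
def odeSol (K : ℝ → A) (l : ℂ) (y : ℝ) : A := ∑' n, l ^ n • iterInt K n y

/-- The derivative of `odeSol` in the parameter. -/
def odeSolDeriv (K : ℝ → A) (l : ℂ) (y : ℝ) : A :=
  ∑' n : ℕ, (((n : ℂ) + 1) * l ^ n) • iterInt K (n + 1) y

theorem odeSol_zero_right (K : ℝ → A) (l : ℂ) : odeSol K l 0 = 1 := by
  rw [odeSol, tsum_eq_single 0]
  · simp [iterInt]
  · rintro (_ | n) hn
    · exact absurd rfl hn
    · rw [iterInt_succ_zero, smul_zero]

theorem odeSol_zero_left (K : ℝ → A) (y : ℝ) : odeSol K 0 y = 1 := by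
  rw [odeSol, tsum_eq_single 0]
  · simp [iterInt]
  · intro n hn
    rw [zero_pow hn, zero_smul]

variable [CompleteSpace A]

theorem summable_odeSol {K : ℝ → A} (hK : Continuous K) (l : ℂ) (y : ℝ) :
    Summable fun n => l ^ n • iterInt K n y := by
  obtain ⟨c, x, k, hc, hx, hk, -, hb⟩ := exists_iterInt_bound hK (|y| + 1)
  refine Summable.of_norm_bounded
    ((Real.summable_pow_div_factorial (‖l‖ * x)).mul_left c) fun n => ?_
  rw [norm_smul, norm_pow]
  calc ‖l‖ ^ n * ‖iterInt K n y‖ ≤ ‖l‖ ^ n * (c * (x ^ n / n !)) := by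
        gcongr; exact hb n y (by linarith)
    _ = c * ((‖l‖ * x) ^ n / n !) := by rw [mul_pow]; ring

theorem summable_odeSolDeriv {K : ℝ → A} (hK : Continuous K) (l : ℂ) (y : ℝ) :
    Summable fun n : ℕ => (((n : ℂ) + 1) * l ^ n) • iterInt K (n + 1) y := by
  obtain ⟨c, x, k, hc, hx, hk, -, hb⟩ := exists_iterInt_bound hK (|y| + 1)
  refine Summable.of_norm_bounded
    ((Real.summable_pow_div_factorial (‖l‖ * x)).mul_left (c * x)) fun n => ?_
  rw [norm_smul, norm_mul, norm_pow]
  have h1 : ‖(n : ℂ) + 1‖ = n + 1 := by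
    rw [← Nat.cast_succ, Complex.norm_natCast]; push_cast; rfl
  rw [h1]
  calc ((n : ℝ) + 1) * ‖l‖ ^ n * ‖iterInt K (n + 1) y‖
      ≤ ((n : ℝ) + 1) * ‖l‖ ^ n * (c * (x ^ (n + 1) / (n + 1)!)) := by
        gcongr; exact hb _ y (by linarith)
    _ = c * x * ((‖l‖ * x) ^ n / n !) := by
        have := Nat.factorial_ne_zero n
        rw [mul_pow, Nat.factorial_succ, pow_succ]; push_cast; field_simp

theorem hasDerivAt_odeSol {K : ℝ → A} (hK : Continuous K) (l : ℂ) (y : ℝ) :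
    HasDerivAt (odeSol K l) (l • (odeSol K l y * K y)) y := by
  obtain ⟨c, x, k, hc, hx, hk, hkb, hb⟩ := exists_iterInt_bound hK (|y| + 1)
  -- With the constant term split off, every remaining term is an integral whose derivative involves
  -- the preceding iterated integral.
  have hsplit : odeSol K l = fun s => 1 + ∑' n : ℕ, l ^ (n + 1) • iterInt K (n + 1) s := by
    funext s
    rw [odeSol, (summable_odeSol hK l s).tsum_eq_zero_add]
    simp [iterInt]
  have hval : l • (odeSol K l y * K y)
      = ∑' n : ℕ, l ^ (n + 1) • (iterInt K n y * K y) := by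
    rw [odeSol, ← (summable_odeSol hK l y).tsum_mul_right,
      ← ((summable_odeSol hK l y).mul_right (K y)).tsum_const_smul]
    refine tsum_congr fun n => ?_
    rw [smul_mul_assoc, smul_smul, ← pow_succ']
  rw [hval, hsplit]
  have hu : Summable fun n : ℕ => c * k * ‖l‖ * ((‖l‖ * x) ^ n / n !) :=
    (Real.summable_pow_div_factorial (‖l‖ * x)).mul_left _
  have hy : y ∈ Metric.ball (0 : ℝ) (|y| + 1) := by simp
  have hg0 : Summable fun n => l ^ (n + 1) • iterInt K (n + 1) y :=
    (summable_nat_add_iff (f := fun n => l ^ n • iterInt K n y) 1).2 (summable_odeSol hK l y)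
  refine HasDerivAt.const_add (1 : A) ?_
  refine (hasDerivAt_tsum_of_isPreconnected
    (g := fun n s => l ^ (n + 1) • iterInt K (n + 1) s)
    (g' := fun n s => l ^ (n + 1) • (iterInt K n s * K s)) hu Metric.isOpen_ball
    (convex_ball _ _).isPreconnected
    (fun n s _ => (hasDerivAt_iterInt_succ hK n s).fun_const_smul _) (fun n s hs => ?_) hy hg0 hy)
  rw [mem_ball_zero_iff, Real.norm_eq_abs] at hs
  rw [norm_smul, norm_pow]
  calc ‖l‖ ^ (n + 1) * ‖iterInt K n s * K s‖
      ≤ ‖l‖ ^ (n + 1) * ((c * (x ^ n / n !)) * k) := by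
        gcongr
        exact (norm_mul_le _ _).trans
          (mul_le_mul (hb n s hs) (hkb s hs) (norm_nonneg _) (by positivity))
    _ = c * k * ‖l‖ * ((‖l‖ * x) ^ n / n !) := by rw [mul_pow]; ring

theorem hasDerivAt_odeSol_param {K : ℝ → A} (hK : Continuous K) (l : ℂ) (y : ℝ) :
    HasDerivAt (fun w => odeSol K w y) (odeSolDeriv K l y) l := by
  obtain ⟨c, x, k, hc, hx, hk, hkb, hb⟩ := exists_iterInt_bound hK (|y| + 1)
  have hsplit : (fun w => odeSol K w y)
      = fun w => 1 + ∑' n : ℕ, w ^ (n + 1) • iterInt K (n + 1) y := by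
    funext w
    rw [odeSol, (summable_odeSol hK w y).tsum_eq_zero_add]
    simp [iterInt]
  rw [hsplit, odeSolDeriv]
  have hu : Summable fun n : ℕ => c * x * (((‖l‖ + 1) * x) ^ n / n !) :=
    (Real.summable_pow_div_factorial ((‖l‖ + 1) * x)).mul_left _
  have hl : l ∈ Metric.ball (0 : ℂ) (‖l‖ + 1) := by simp
  have hg0 : Summable fun n => l ^ (n + 1) • iterInt K (n + 1) y :=
    (summable_nat_add_iff (f := fun n => l ^ n • iterInt K n y) 1).2 (summable_odeSol hK l y)
  refine HasDerivAt.const_add (1 : A) ?_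
  refine (hasDerivAt_tsum_of_isPreconnected
    (g := fun n w => w ^ (n + 1) • iterInt K (n + 1) y)
    (g' := fun n w => (((n : ℂ) + 1) * w ^ n) • iterInt K (n + 1) y) hu Metric.isOpen_ball
    (convex_ball _ _).isPreconnected (fun n s _ => ?_) (fun n s hs => ?_) hl hg0 hl)
  · have := (hasDerivAt_pow (n + 1) s).smul_const (iterInt K (n + 1) y)
    simpa using this
  rw [mem_ball_zero_iff] at hs
  have h1 : ‖(n : ℂ) + 1‖ = n + 1 := by
    rw [← Nat.cast_succ, Complex.norm_natCast]; push_cast; rfl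
  rw [norm_smul, norm_mul, norm_pow, h1]
  calc ((n : ℝ) + 1) * ‖s‖ ^ n * ‖iterInt K (n + 1) y‖
      ≤ ((n : ℝ) + 1) * (‖l‖ + 1) ^ n * (c * (x ^ (n + 1) / (n + 1)!)) := by
        gcongr; exact hb _ y (by linarith)
    _ = c * x * (((‖l‖ + 1) * x) ^ n / n !) := by
        have := Nat.factorial_ne_zero n
        rw [mul_pow, Nat.factorial_succ, pow_succ]; push_cast; field_simp

/-- The variational equation, i.e. `C' = λ C K` differentiated in `λ`. Termwise differentiation in
`y` makes an interchange of derivatives unnecessary. -/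
theorem hasDerivAt_odeSolDeriv {K : ℝ → A} (hK : Continuous K) (l : ℂ) (y : ℝ) :
    HasDerivAt (odeSolDeriv K l) (odeSol K l y * K y + l • (odeSolDeriv K l y * K y)) y := by
  obtain ⟨c, x, k, hc, hx, hk, hkb, hb⟩ := exists_iterInt_bound hK (|y| + 1)
  have hval : odeSol K l y * K y + l • (odeSolDeriv K l y * K y)
      = ∑' n : ℕ, (((n : ℂ) + 1) * l ^ n) • (iterInt K n y * K y) := by
    have hs0 := (summable_odeSol hK l y).mul_right (K y)
    have hs1 := ((summable_odeSolDeriv hK l y).mul_right (K y)).const_smul l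
    have e1 : ∀ n : ℕ, (((n + 1 : ℕ) : ℂ) * l ^ (n + 1)) • (iterInt K (n + 1) y * K y)
        = l • ((((n : ℂ) + 1) * l ^ n) • iterInt K (n + 1) y * K y) := by
      intro n
      rw [smul_mul_assoc, smul_smul]; push_cast; congr 1; ring
    -- Splitting `n + 1` into `1` and `n` separates the two terms; the `n`-weighted series vanishes
    -- at `n = 0` and shifts to `λ` times the derivative series.
    have hs2 : Summable fun n : ℕ => ((n : ℂ) * l ^ n) • (iterInt K n y * K y) := by
      refine (summable_nat_add_iff 1).1 (hs1.congr fun n => (e1 n).symm)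
    have h2 : ∑' n : ℕ, ((n : ℂ) * l ^ n) • (iterInt K n y * K y)
        = l • (odeSolDeriv K l y * K y) := by
      rw [hs2.tsum_eq_zero_add, odeSolDeriv, ← (summable_odeSolDeriv hK l y).tsum_mul_right,
        ← ((summable_odeSolDeriv hK l y).mul_right (K y)).tsum_const_smul]
      simp only [Nat.cast_zero, zero_mul, zero_smul, zero_add]
      exact tsum_congr e1
    rw [← h2, odeSol, ← (summable_odeSol hK l y).tsum_mul_right, ← hs0.tsum_add hs2]
    refine tsum_congr fun n => ?_
    rw [smul_mul_assoc, ← add_smul]; congr 1; ring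
  rw [hval]
  have hu : Summable fun n : ℕ => c * k * (((n : ℝ) + 1) * ((‖l‖ * x) ^ n / n !)) :=
    (summable_succ_mul_pow_div_factorial (‖l‖ * x) (by positivity)).mul_left _
  have hy : y ∈ Metric.ball (0 : ℝ) (|y| + 1) := by simp
  refine hasDerivAt_tsum_of_isPreconnected
    (g := fun (n : ℕ) s => (((n : ℂ) + 1) * l ^ n) • iterInt K (n + 1) s)
    (g' := fun (n : ℕ) s => (((n : ℂ) + 1) * l ^ n) • (iterInt K n s * K s))
    hu Metric.isOpen_ball (convex_ball _ _).isPreconnected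
    (fun n s _ => (hasDerivAt_iterInt_succ hK n s).fun_const_smul _) (fun n s hs => ?_) hy
    (summable_odeSolDeriv hK l y) hy
  rw [mem_ball_zero_iff, Real.norm_eq_abs] at hs
  have h1 : ‖(n : ℂ) + 1‖ = n + 1 := by
    rw [← Nat.cast_succ, Complex.norm_natCast]; push_cast; rfl
  rw [norm_smul, norm_mul, norm_pow, h1]
  calc ((n : ℝ) + 1) * ‖l‖ ^ n * ‖iterInt K n s * K s‖
      ≤ ((n : ℝ) + 1) * ‖l‖ ^ n * ((c * (x ^ n / n !)) * k) := by
        gcongr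
        exact (norm_mul_le _ _).trans
          (mul_le_mul (hb n s hs) (hkb s hs) (norm_nonneg _) (by positivity))
    _ = c * k * (((n : ℝ) + 1) * ((‖l‖ * x) ^ n / n !)) := by rw [mul_pow]; ring

end LinearODE

/-! ### The Lax pair and the positive Iwasawa factor -/

section Frame

open scoped Matrix.Norms.Operator

/-- The Lax system `p' = 2 (q² - r²)`, `q' = -2 p q`, `r' = 2 p r`. -/
structure IsLaxSolution (a b : ℝ) (p q r : ℝ → ℝ) : Prop where
  hasDerivAt_p : ∀ y, HasDerivAt p (2 * (q y ^ 2 - r y ^ 2)) y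
  hasDerivAt_q : ∀ y, HasDerivAt q (-2 * p y * q y) y
  hasDerivAt_r : ∀ y, HasDerivAt r (2 * p y * r y) y
  p_zero : p 0 = 0
  q_zero : q 0 = a
  r_zero : r 0 = b

/-- The `dx`-part of the Maurer--Cartan form of the frame. -/
def laxU (p q r : ℝ) (l : ℂ) : Mat2 :=
  Complex.I • !![(p : ℂ), q * l⁻¹ + r * l; r * l⁻¹ + q * l, -p]

/-- The `dy`-part of the Maurer--Cartan form of the frame. -/
def laxV (q r : ℝ) (l : ℂ) : Mat2 := !![0, r * l - q * l⁻¹; q * l - r * l⁻¹, 0]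

/-- The `λ`-holomorphic part of `i U`. -/
def laxW (p q r : ℝ) (l : ℂ) : Mat2 := !![-(p : ℂ), -2 * r * l; -2 * q * l, p]

/-- The derivative of `laxW` in `λ`. -/
def laxW' (q r : ℝ) : Mat2 := !![0, -2 * (r : ℂ); -2 * q, 0]

/-- The derivative of `laxU` in `t`, where `λ = exp (i t)`. -/
def laxU' (q r : ℝ) (l : ℂ) : Mat2 := !![0, q * l⁻¹ - r * l; r * l⁻¹ - q * l, 0]

/-- The derivative of `laxV` in `t`, where `λ = exp (i t)`. -/
def laxV' (q r : ℝ) (l : ℂ) : Mat2 :=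
  Complex.I • !![0, r * l + q * l⁻¹; q * l + r * l⁻¹, 0]

theorem laxU_sub_laxW (p q r : ℝ) (l : ℂ) :
    Complex.I • laxU p q r l - laxW p q r l = laxV q r l := by
  ext i j
  fin_cases i <;> fin_cases j <;> simp [laxU, laxW, laxV, ← mul_assoc] <;> ring

theorem laxU'_sub_laxW' (q r : ℝ) (l : ℂ) :
    Complex.I • laxU' q r l - (Complex.I * l) • laxW' q r = laxV' q r l := by
  ext i j
  fin_cases i <;> fin_cases j <;> simp [laxU', laxW', laxV'] <;> ring

theorem normalForm_eq_laxU (a b : ℝ) (μ : Circle) : normalForm a b μ = laxU 0 a b μ := by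
  simp [normalForm, laxU]

/-- A matrix entry, as a continuous linear map. -/
def entryCLM (𝕜 : Type*) [NontriviallyNormedField 𝕜] [CompleteSpace 𝕜] [NormedAlgebra 𝕜 ℂ]
    [FiniteDimensional 𝕜 Mat2] (i j : Fin 2) : Mat2 →L[𝕜] ℂ :=
  LinearMap.toContinuousLinearMap (Matrix.entryLinearMap 𝕜 ℂ i j)

theorem mat_eq_smul_add (X : Mat2) :
    X = X 0 0 • !![1, 0; 0, 0] + X 0 1 • !![0, 1; 0, 0] + X 1 0 • !![0, 0; 1, 0]
      + X 1 1 • !![0, 0; 0, 1] := by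
  ext i j
  fin_cases i <;> fin_cases j <;> simp

theorem hasDerivAt_mat {𝕜 : Type*} [NontriviallyNormedField 𝕜] [NormedAlgebra 𝕜 ℂ]
    {f : 𝕜 → Mat2} {f' : Mat2} {x : 𝕜}
    (h : ∀ i j, HasDerivAt (fun y => f y i j) (f' i j) x) : HasDerivAt f f' x := by
  have := ((((h 0 0).smul_const (!![1, 0; 0, 0] : Mat2)).add
    ((h 0 1).smul_const (!![0, 1; 0, 0] : Mat2))).add
    ((h 1 0).smul_const (!![0, 0; 1, 0] : Mat2))).add
    ((h 1 1).smul_const (!![0, 0; 0, 1] : Mat2))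
  rw [← mat_eq_smul_add f'] at this
  exact this.congr_of_eventuallyEq (.of_forall fun y => mat_eq_smul_add (f y))

theorem hasDerivAt_entry {f : ℝ → Mat2} {f' : Mat2} {x : ℝ} (h : HasDerivAt f f' x)
    (i j : Fin 2) : HasDerivAt (fun y => f y i j) (f' i j) x :=
  (entryCLM ℝ i j).hasFDerivAt.comp_hasDerivAt x h

theorem hasDerivAt_entry_complex {f : ℂ → Mat2} {f' : Mat2} {x : ℂ} (h : HasDerivAt f f' x)
    (i j : Fin 2) : HasDerivAt (fun y => f y i j) (f' i j) x :=
  (entryCLM ℂ i j).hasFDerivAt.comp_hasDerivAt x h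

theorem continuous_mat {X : Type*} [TopologicalSpace X] {f : X → Mat2}
    (h : ∀ i j, Continuous fun y => f y i j) : Continuous f :=
  continuous_matrix h

theorem hasDerivAt_const_of_eq_zero {f : ℝ → Mat2} (h : ∀ y, HasDerivAt f 0 y) (y : ℝ) :
    f y = f 0 :=
  is_const_of_deriv_eq_zero (fun y => (h y).differentiableAt) (fun y => (h y).deriv) _ _

/-- The inverse of the positive factor of the frame, with its derivative `Rd` in `λ`. -/
theorem exists_positiveFactor {p q r P : ℝ → ℝ} (hq : Continuous q)
    (hr : Continuous r) (hP : ∀ y, HasDerivAt P (p y) y) (hP0 : P 0 = 0) :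
    ∃ R Rd : ℂ → ℝ → Mat2, (∀ l, R l 0 = 1) ∧
      (∀ y, R 0 y = !![(Real.exp (P y) : ℂ), 0; 0, (Real.exp (P y) : ℂ)⁻¹]) ∧
      (∀ l y, HasDerivAt (R l) (-(R l y * laxW (p y) (q y) (r y) l)) y) ∧
      (∀ l y, HasDerivAt (fun w => R w y) (Rd l y) l) ∧
      (∀ l y, HasDerivAt (Rd l)
        (-(Rd l y * laxW (p y) (q y) (r y) l + R l y * laxW' (q y) (r y))) y) := by
  have hPc : Continuous P := continuous_iff_continuousAt.2 fun y => (hP y).continuousAt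
  -- The substitution `R = C G` with `G = diag(e^P, e^{-P})` removes the diagonal part of `W`; `K`
  -- is minus the off-diagonal part of `W`, stripped of its factor `λ` and conjugated by `G`. Hence
  -- `C` is a power series in `λ` and `R(0) = G`.
  set K : ℝ → Mat2 := fun y =>
    !![0, 2 * (r y : ℂ) * (Real.exp (P y) * Real.exp (P y) : ℝ);
      2 * (q y : ℂ) * (Real.exp (-P y) * Real.exp (-P y) : ℝ), 0] with hKdef
  set G : ℝ → Mat2 := fun y => !![(Real.exp (P y) : ℂ), 0; 0, (Real.exp (-P y) : ℂ)] with hGdef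
  have hK : Continuous K := by
    refine continuous_mat fun i j => ?_
    fin_cases i <;> fin_cases j <;> simp [hKdef] <;> fun_prop
  have hG : ∀ y, HasDerivAt G !![(p y * Real.exp (P y) : ℂ), 0; 0,
      -(p y * Real.exp (-P y) : ℂ)] y := by
    intro y
    refine hasDerivAt_mat fun i j => ?_
    have h1 := (hP y).exp.ofReal_comp
    have h2 := (hP y).fun_neg.exp.ofReal_comp
    fin_cases i <;> fin_cases j
    · exact h1.congr_deriv (by simp [mul_comm])
    · simpa [hGdef] using hasDerivAt_const y (0 : ℂ)
    · simpa [hGdef] using hasDerivAt_const y (0 : ℂ)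
    · exact h2.congr_deriv (by simp [mul_comm])
  have hexp : ∀ y, ((Real.exp (P y) : ℝ) : ℂ) * (Real.exp (-P y) : ℝ) = 1 := by
    intro y; rw [← Complex.ofReal_mul, ← Real.exp_add]; simp
  have key1 : ∀ l y, l • (K y * G y) + !![(p y * Real.exp (P y) : ℂ), 0; 0,
      -(p y * Real.exp (-P y) : ℂ)] = -(G y * laxW (p y) (q y) (r y) l) := by
    intro l y
    have := hexp y
    ext i j
    fin_cases i <;> fin_cases j <;>
      simp [hKdef, hGdef, laxW, -Complex.ofReal_exp] <;> grind
  have key2 : ∀ y, K y * G y = -(G y * laxW' (q y) (r y)) := by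
    intro y
    have := hexp y
    ext i j
    fin_cases i <;> fin_cases j <;>
      simp [hKdef, hGdef, laxW', Matrix.mul_apply, -Complex.ofReal_exp] <;> grind
  refine ⟨fun l y => odeSol K l y * G y, fun l y => odeSolDeriv K l y * G y, fun l => ?_,
    fun y => ?_, fun l y => ?_, fun l y => ?_, fun l y => ?_⟩
  · simp only [odeSol_zero_right, hGdef, hP0, one_mul]
    ext i j
    fin_cases i <;> fin_cases j <;> simp
  · simp only [odeSol_zero_left, hGdef, one_mul, Real.exp_neg, Complex.ofReal_inv]
  · refine ((hasDerivAt_odeSol hK l y).mul (hG y)).congr_deriv ?_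
    rw [mul_assoc, ← mul_neg (odeSol K l y), ← key1, mul_add, mul_smul_comm, smul_mul_assoc,
      mul_assoc]
  · exact (hasDerivAt_odeSol_param hK l y).mul_const (G y)
  · refine ((hasDerivAt_odeSolDeriv hK l y).mul (hG y)).congr_deriv ?_
    simp only
    rw [neg_add, mul_assoc (odeSolDeriv K l y), ← mul_neg (odeSolDeriv K l y), ← key1,
      mul_assoc (odeSol K l y) (G y), ← mul_neg (odeSol K l y), ← key2, mul_add, mul_smul_comm, add_mul, smul_mul_assoc, mul_assoc, mul_assoc]
    abel

/-- The system for `p, q, r` is exactly `U' = [W, U]` read entrywise; `λ ≠ 0` is used for `λ λ⁻¹ =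
1` on the diagonal. -/
theorem hasDerivAt_laxU {a b : ℝ} {p q r : ℝ → ℝ} (h : IsLaxSolution a b p q r) {l : ℂ}
    (hl : l ≠ 0) (y : ℝ) :
    HasDerivAt (fun y => laxU (p y) (q y) (r y) l)
      (laxW (p y) (q y) (r y) l * laxU (p y) (q y) (r y) l
        - laxU (p y) (q y) (r y) l * laxW (p y) (q y) (r y) l) y := by
  have hp := (h.hasDerivAt_p y).ofReal_comp
  have hq := (h.hasDerivAt_q y).ofReal_comp
  have hr := (h.hasDerivAt_r y).ofReal_comp
  refine hasDerivAt_mat fun i j => ?_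
  fin_cases i <;> fin_cases j
  · refine (hp.const_mul Complex.I).congr_deriv ?_
    simp [laxU, laxW]; field_simp; ring
  · refine (((hq.mul_const l⁻¹).add (hr.mul_const l)).const_mul Complex.I).congr_deriv ?_
    simp [laxU, laxW]; ring
  · refine (((hr.mul_const l⁻¹).add (hq.mul_const l)).const_mul Complex.I).congr_deriv ?_
    simp [laxU, laxW]; ring
  · refine (hp.neg.const_mul Complex.I).congr_deriv ?_
    simp [laxU, laxW]; field_simp; ring

/-- For `2 × 2` matrices the adjugate is linear, so it can stand in for the inverse before
invertibility is known. -/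
theorem hasDerivAt_adjugate {f : ℝ → Mat2} {f' : Mat2} {y : ℝ} (h : HasDerivAt f f' y) :
    HasDerivAt (fun y => (f y).adjugate) f'.adjugate y := by
  simp only [Matrix.adjugate_fin_two]
  refine hasDerivAt_mat fun i j => ?_
  fin_cases i <;> fin_cases j
  · exact hasDerivAt_entry h 1 1
  · exact (hasDerivAt_entry h 0 1).neg
  · exact (hasDerivAt_entry h 1 0).neg
  · exact hasDerivAt_entry h 0 0

theorem adjugate_laxW (p q r : ℝ) (l : ℂ) : (laxW p q r l).adjugate = -laxW p q r l := by
  rw [Matrix.adjugate_fin_two]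
  ext i j
  fin_cases i <;> fin_cases j <;> simp [laxW]

/-- The positive factor intertwines the potential and the Maurer--Cartan form. -/
theorem laxU_mul_eq {a b : ℝ} {p q r : ℝ → ℝ} (h : IsLaxSolution a b p q r) {l : ℂ}
    (hl : l ≠ 0) {R : ℝ → Mat2} (hR0 : R 0 = 1)
    (hR : ∀ y, HasDerivAt R (-(R y * laxW (p y) (q y) (r y) l)) y) (y : ℝ) :
    laxU 0 a b l * R y = R y * laxU (p y) (q y) (r y) l := by
  have hadj : ∀ y, HasDerivAt (fun y => (R y).adjugate)
      (laxW (p y) (q y) (r y) l * (R y).adjugate) y := by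
    intro y
    refine (hasDerivAt_adjugate (hR y)).congr_deriv ?_
    rw [← mul_neg, Matrix.adjugate_mul_distrib, ← neg_one_smul ℂ (laxW _ _ _ _),
      Matrix.adjugate_smul, adjugate_laxW]
    simp
  -- As `W` is traceless, the adjugate of `R` satisfies the equation of `R⁻¹`, and the product keeps
  -- its value at `0`.
  have hdet : R y * (R y).adjugate = 1 := by
    have := hasDerivAt_const_of_eq_zero (f := fun y => R y * (R y).adjugate) (fun y => by
      refine ((hR y).mul (hadj y)).congr_deriv ?_
      noncomm_ring) y
    simpa [hR0] using this
  -- Conjugation by `R` turns the Lax equation into constancy.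
  have hconj : R y * laxU (p y) (q y) (r y) l * (R y).adjugate = laxU 0 a b l := by
    have := hasDerivAt_const_of_eq_zero
      (f := fun y => R y * laxU (p y) (q y) (r y) l * (R y).adjugate) (fun y => by
      refine (((hR y).fun_mul (hasDerivAt_laxU h hl y)).fun_mul (hadj y)).congr_deriv ?_
      noncomm_ring) y
    simpa [hR0, h.p_zero, h.q_zero, h.r_zero] using this
  rw [← hconj, mul_assoc, mul_eq_one_comm.mp hdet, mul_one]

end Frame

/-! ### Differentiating `exp(zX(t))` in the parameter -/

section ExpParam

open NormedSpace

variable {A : Type*} [NormedRing A] [NormedAlgebra ℂ A] [CompleteSpace A]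

/-- The derivative of `exp (z X(t))` in `t`, and the mixed derivative in `z` and `t`. -/
theorem exists_hasDerivAt_exp_smul_param {X : ℝ → A} {X' : A} (hX : ContDiff ℝ 2 X)
    (hX' : HasDerivAt X X' 0) :
    ∃ φ : ℂ → A, (∀ z, HasDerivAt (fun t => exp (z • X t)) (φ z) 0) ∧
      ∀ z, HasDerivAt φ (φ z * X 0 + exp (z • X 0) * X') z := by
  set G : ℂ × ℝ → A := fun w => exp (w.1 • X w.2) with hGdef
  have hexp : ContDiff ℝ 2 (exp : A → A) :=
    contDiff_iff_contDiffAt.2 fun x => (exp_analytic (𝕂 := ℝ) x).contDiffAt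
  have hG : ContDiff ℝ 2 G := hexp.comp (contDiff_fst.smul (hX.comp contDiff_snd))
  have hGd : ∀ w, HasFDerivAt G (fderiv ℝ G w) w := fun w =>
    (hG.differentiable (by norm_num) w).hasFDerivAt
  have hG' : Differentiable ℝ (fderiv ℝ G) :=
    (hG.fderiv_right (m := 1) (by norm_num)).differentiable (by norm_num)
  have hz : ∀ z t w, fderiv ℝ G (z, t) (w, 0) = w • (G (z, t) * X t) := by
    intro z t w
    have h1 : HasFDerivAt (fun u : ℂ => G (u, t))
        ((fderiv ℝ G (z, t)).comp (ContinuousLinearMap.inl ℝ ℂ ℝ)) z :=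
      (hGd (z, t)).comp (f := fun u : ℂ => (u, t)) z (hasFDerivAt_prodMk_left z t)
    have h2 : HasFDerivAt (fun u : ℂ => G (u, t)) _ z :=
      (hasDerivAt_exp_smul_const (𝕂 := ℂ) (X t) z).hasFDerivAt.restrictScalars ℝ
    have := congrArg (fun L : ℂ →L[ℝ] A => L w) (h1.unique h2)
    simpa [hGdef] using this
  have ht : ∀ z, HasDerivAt (fun t => G (z, t)) (fderiv ℝ G (z, 0) (0, 1)) 0 := by
    intro z
    exact (hGd (z, 0)).comp_hasDerivAt 0 ((hasDerivAt_const _ _).prodMk (hasDerivAt_id _))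
  refine ⟨fun z => fderiv ℝ G (z, 0) (0, 1), ht, fun z => ?_⟩
  -- Symmetry of the second derivative replaces a formula for the derivative of the exponential in
  -- `t`: the `z`-derivative is explicit for every `t`, and can be differentiated in `t`.
  have hsymm := hG.contDiffAt.isSymmSndFDerivAt (x := (z, (0 : ℝ))) (by simp)
  have h1 : HasFDerivAt (fun u : ℂ => fderiv ℝ G (u, 0) (0, 1))
      ((ContinuousLinearMap.apply ℝ A ((0, 1) : ℂ × ℝ)).comp
        ((fderiv ℝ (fderiv ℝ G) (z, 0)).comp (ContinuousLinearMap.inl ℝ ℂ ℝ))) z :=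
    (ContinuousLinearMap.apply ℝ A ((0, 1) : ℂ × ℝ)).hasFDerivAt.comp z
      ((hG' (z, 0)).hasFDerivAt.comp z (hasFDerivAt_prodMk_left z (0 : ℝ)))
  refine (hasFDerivAt_of_restrictScalars ℝ h1 ?_ :
    HasFDerivAt _ (ContinuousLinearMap.toSpanSingleton ℂ
      (fderiv ℝ G (z, 0) (0, 1) * X 0 + exp (z • X 0) * X')) z).hasDerivAt.congr_deriv (by simp)
  ext1 w
  have h2 : HasDerivAt (fun t => fderiv ℝ G (z, t) (w, 0))
      (fderiv ℝ (fderiv ℝ G) (z, 0) (0, 1) (w, 0)) 0 :=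
    (ContinuousLinearMap.apply ℝ A ((w, 0) : ℂ × ℝ)).hasFDerivAt.comp_hasDerivAt (0 : ℝ)
      ((hG' (z, 0)).hasFDerivAt.comp_hasDerivAt (0 : ℝ)
        ((hasDerivAt_const _ _).prodMk (hasDerivAt_id _)))
  have h3 : HasDerivAt (fun t => fderiv ℝ G (z, t) (w, 0)) _ 0 :=
    (((ht z).fun_mul hX').fun_const_smul w).congr_of_eventuallyEq
      (.of_forall fun t => hz z t w)
  have h4 := h2.unique h3
  simp only [ContinuousLinearMap.coe_restrictScalars', ContinuousLinearMap.toSpanSingleton_apply,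
    ContinuousLinearMap.comp_apply, ContinuousLinearMap.inl_apply,
    ContinuousLinearMap.apply_apply]
  rw [hsymm.eq, h4]

end ExpParam

/-! ### Real differentials of maps of the plane -/

section PlaneDeriv

variable {E : Type*} [NormedAddCommGroup E] [NormedSpace ℝ E]

/-- The linear map `w ↦ (re w) X + (im w) Y`, the differential of a map of the `z = x + i y`-plane
with partial derivatives `X`, `Y`. -/
def planeDeriv (X Y : E) : ℂ →L[ℝ] E :=
  Complex.reCLM.smulRight X + Complex.imCLM.smulRight Y

@[simp]
theorem planeDeriv_apply (X Y : E) (w : ℂ) : planeDeriv X Y w = w.re • X + w.im • Y := rfl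

/-- A map whose partial derivatives are smooth functions of `z` and of the map is smooth. -/
theorem contDiff_of_hasFDerivAt_planeDeriv {f X Y : ℂ → E}
    (hf : ∀ z, HasFDerivAt f (planeDeriv (X z) (Y z)) z) {n : ℕ} (hX : ContDiff ℝ n X)
    (hY : ContDiff ℝ n Y) : ContDiff ℝ (n + 1) f := by
  rw [contDiff_succ_iff_hasFDerivAt]
  refine ⟨fun z => planeDeriv (X z) (Y z), ?_, hf⟩
  exact (contDiff_const.smulRight hX).add (contDiff_const.smulRight hY)

/-- The holomorphic factor has `y`-derivative `i` times its `x`-derivative, while the other factor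
varies only with `y`. This is the source of the `iU` in `V = iU - W`. -/
theorem hasFDerivAt_mul_comp_im {A : Type*} [NormedRing A]
    [NormedAlgebra ℂ A] {E : ℂ → A} {R : ℝ → A} {E' R' : A} {z : ℂ}
    (hE : HasDerivAt E E' z) (hR : HasDerivAt R R' z.im) :
    HasFDerivAt (fun z => E z * R z.im)
      (planeDeriv (E' * R z.im) (Complex.I • (E' * R z.im) + E z * R')) z := by
  have h1 := hE.hasFDerivAt.restrictScalars ℝ
  have h2 : HasFDerivAt (fun z : ℂ => R z.im) _ z :=
    hR.hasFDerivAt.comp z Complex.imCLM.hasFDerivAt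
  refine (h1.mul' h2).congr_fderiv ?_
  ext1 w
  have hw : w • (E' * R z.im) = w.re • (E' * R z.im) + w.im • Complex.I • (E' * R z.im) := by
    conv_lhs => rw [← Complex.re_add_im w]
    rw [add_smul, mul_smul, Complex.coe_smul, Complex.coe_smul]
  simp [planeDeriv, hw]
  abel

end PlaneDeriv

/-! ### Differentiating the Lax matrix along the circle -/

section Frame

open scoped Matrix.Norms.Operator

open NormedSpace

theorem hasDerivAt_circleExp_mul (μ : Circle) :
    HasDerivAt (fun t : ℝ => ((Circle.exp t * μ : Circle) : ℂ)) (Complex.I * μ) 0 := by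
  have h : HasDerivAt (fun t : ℝ => Complex.exp (t * Complex.I) * (μ : ℂ))
      (Complex.exp ((0 : ℝ) * Complex.I) * (1 * Complex.I) * μ) 0 :=
    (((hasDerivAt_id (0 : ℝ)).ofReal_comp.mul_const Complex.I).cexp).mul_const _
  simpa using h

theorem hasDerivAt_laxU_circle (p q r : ℝ) (μ : Circle) :
    HasDerivAt (fun t : ℝ => laxU p q r (Circle.exp t * μ : Circle)) (laxU' q r μ) 0 := by
  have h := hasDerivAt_circleExp_mul μ
  have hi := h.fun_inv (by simp)
  simp only [Circle.exp_zero, one_mul] at hi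
  have hμ := μ.coe_ne_zero
  have hI := Complex.I_sq
  refine hasDerivAt_mat fun i j => ?_
  fin_cases i <;> fin_cases j
  · exact (hasDerivAt_const (0 : ℝ) (Complex.I * p)).congr_deriv (by simp [laxU'])
  · refine (((hi.const_mul (q : ℂ)).add (h.const_mul (r : ℂ))).const_mul Complex.I).congr_deriv ?_
    simp [laxU']; field_simp; rw [hI]; ring
  · refine (((hi.const_mul (r : ℂ)).add (h.const_mul (q : ℂ))).const_mul Complex.I).congr_deriv ?_
    simp [laxU']; field_simp; rw [hI]; ring
  · exact (hasDerivAt_const (0 : ℝ) (Complex.I * -p)).congr_deriv (by simp [laxU'])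

theorem contDiff_mat {E : Type*} [NormedAddCommGroup E] [NormedSpace ℝ E] {f : E → Mat2}
    {n : ℕ∞ω} (h : ∀ i j, ContDiff ℝ n fun x => f x i j) : ContDiff ℝ n f := by
  have := ((((h 0 0).smul (contDiff_const (c := (!![1, 0; 0, 0] : Mat2)))).add
    ((h 0 1).smul (contDiff_const (c := (!![0, 1; 0, 0] : Mat2))))).add
    ((h 1 0).smul (contDiff_const (c := (!![0, 0; 1, 0] : Mat2))))).add
    ((h 1 1).smul (contDiff_const (c := (!![0, 0; 0, 1] : Mat2))))
  convert this using 1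
  exact funext fun x => mat_eq_smul_add (f x)

theorem contDiff_laxU_circle (p q r : ℝ) (μ : Circle) {n : ℕ∞ω} :
    ContDiff ℝ n (fun t : ℝ => laxU p q r (Circle.exp t * μ : Circle)) := by
  have h : ContDiff ℝ n (fun t : ℝ => ((Circle.exp t * μ : Circle) : ℂ)) := by
    simp only [Circle.coe_mul, Circle.coe_exp]
    have h1 : ContDiff ℝ n fun t : ℝ => (t : ℂ) := Complex.ofRealCLM.contDiff
    exact ((h1.mul contDiff_const).cexp).mul contDiff_const
  have hi := h.fun_inv (fun t => Circle.coe_ne_zero _)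
  refine contDiff_mat fun i j => ?_
  fin_cases i <;> fin_cases j
  · exact contDiff_const (c := Complex.I * p)
  · exact contDiff_const.mul ((contDiff_const.mul hi).add (contDiff_const.mul h))
  · exact contDiff_const.mul ((contDiff_const.mul hi).add (contDiff_const.mul h))
  · exact contDiff_const (c := Complex.I * -p)

end Frame

/-! ### Uniqueness of the Iwasawa decomposition -/

section Uniqueness

/-- The modulus attains its maximum at the interior point `0`, so the maximum principle forces
constancy. -/
theorem eq_one_of_norm_le_one_of_apply_zero {g : ℂ → ℂ}
    (hg : DiffContOnCl ℂ g (Metric.ball 0 1)) (hb : ∀ z ∈ Metric.closedBall (0 : ℂ) 1, ‖g z‖ ≤ 1)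
    (h0 : g 0 = 1) (μ : Circle) : g μ = 1 := by
  have hmax : IsMaxOn (norm ∘ g) (Metric.ball 0 1) 0 := by
    intro z hz
    simpa [h0] using hb z (Metric.ball_subset_closedBall hz)
  have := Complex.eqOn_closedBall_of_isMaxOn_norm hg hmax
    (show (μ : ℂ) ∈ Metric.closedBall (0 : ℂ) 1 by simpa using (Circle.norm_coe μ).le)
  simpa [h0] using this

theorem norm_le_one_of_norm_circle_le_one {g : ℂ → ℂ}
    (hg : DiffContOnCl ℂ g (Metric.ball 0 1)) (hb : ∀ μ : Circle, ‖g μ‖ ≤ 1) :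
    ∀ z ∈ Metric.closedBall (0 : ℂ) 1, ‖g z‖ ≤ 1 := by
  intro z hz
  refine Complex.norm_le_of_forall_mem_frontier_norm_le Metric.isBounded_ball hg (fun w hw => ?_)
    (by rwa [closure_ball _ one_ne_zero])
  rw [frontier_ball _ one_ne_zero] at hw
  exact hb ⟨w, hw⟩

/-- A unitary loop whose diagonal entries extend holomorphically to the disc, with value
`diag(ρ, 1 / ρ)`, `ρ > 0`, at `0`, is trivial: uniqueness in the Iwasawa decomposition. -/
theorem eq_one_of_unitary_on_circle {h : ℂ → Mat2}
    (hd : ∀ i, DiffContOnCl ℂ (fun w => h w i i) (Metric.ball 0 1))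
    (hu : ∀ μ : Circle, h μ * (h μ)ᴴ = 1) {ρ : ℝ} (hρ : 0 < ρ) (h0 : h 0 0 0 = ρ)
    (h1 : h 0 1 1 = (ρ : ℂ)⁻¹) (μ : Circle) : h μ = 1 := by
  have row0 : ∀ μ : Circle, ‖h μ 0 0‖ ^ 2 + ‖h μ 0 1‖ ^ 2 = 1 := by
    intro μ
    have := congrFun (congrFun (hu μ) 0) 0
    simp only [Matrix.mul_apply, Fin.sum_univ_two, Matrix.conjTranspose_apply, RCLike.star_def,
      Complex.mul_conj, Complex.normSq_eq_norm_sq, Matrix.one_apply_eq] at this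
    exact_mod_cast this
  have row1 : ∀ μ : Circle, ‖h μ 1 0‖ ^ 2 + ‖h μ 1 1‖ ^ 2 = 1 := by
    intro μ
    have := congrFun (congrFun (hu μ) 1) 1
    simp only [Matrix.mul_apply, Fin.sum_univ_two, Matrix.conjTranspose_apply, RCLike.star_def,
      Complex.mul_conj, Complex.normSq_eq_norm_sq, Matrix.one_apply_eq] at this
    exact_mod_cast this
  have b0 := norm_le_one_of_norm_circle_le_one (hd 0) fun μ => by
    nlinarith [row0 μ, norm_nonneg (h μ 0 0), sq_nonneg ‖h μ 0 1‖]
  have b1 := norm_le_one_of_norm_circle_le_one (hd 1) fun μ => by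
    nlinarith [row1 μ, norm_nonneg (h μ 1 1), sq_nonneg ‖h μ 1 0‖]
  -- Both `ρ` and `1/ρ` are values at `0` of functions bounded by one.
  have hρ1 : ρ = 1 := by
    have e0 := b0 0 (by simp)
    have e1 := b1 0 (by simp)
    simp only [h0, h1, norm_inv, Complex.norm_real, Real.norm_of_nonneg hρ.le] at e0 e1
    have := (inv_le_one₀ hρ).1 e1
    linarith
  have d0 := eq_one_of_norm_le_one_of_apply_zero (hd 0) b0 (by simp [h0, hρ1]) μ
  have d1 := eq_one_of_norm_le_one_of_apply_zero (hd 1) b1 (by simp [h1, hρ1]) μ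
  -- Rows have length one, so a diagonal entry `1` leaves no room for the other entry.
  have o0 : h μ 0 1 = 0 := by have := row0 μ; simpa [d0] using this
  have o1 : h μ 1 0 = 0 := by have := row1 μ; simpa [d1] using this
  ext i j
  fin_cases i <;> fin_cases j <;> simp [d0, d1, o0, o1]

/-- If `E = F B` is the Iwasawa decomposition and `R` is entire with `R(0) = diag(s, 1 / s)`, such
that `E R` is unitary, then `F = E R`. -/
theorem iwasawa_unique {E F B : MatLoop} (hF : IsUnitaryLoop F) (hB : IsPositiveLoop B)
    (hE : ∀ μ, E μ = F μ * B μ) {R : ℂ → Mat2} (hR : ∀ i j, Differentiable ℂ fun w => R w i j)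
    {s : ℝ} (hs : 0 < s) (hR0 : R 0 = !![(s : ℂ), 0; 0, (s : ℂ)⁻¹])
    (hu : ∀ μ : Circle, (E μ * R μ) * (E μ * R μ)ᴴ = 1) (μ : Circle) : F μ = E μ * R μ := by
  obtain ⟨h, hd, hhB, r, hr, h0⟩ := hB.extends_disc
  have hFu : ∀ μ, (F μ)ᴴ * F μ = 1 := fun μ =>
    (Matrix.mem_unitaryGroup_iff'.1 (Matrix.mem_specialUnitaryGroup_iff.1 (hF.mem μ)).1)
  -- The left side `B R` extends holomorphically to the disc, and the right side is unitary on the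
  -- circle.
  have hER : ∀ μ : Circle, h μ * R μ = (F μ)ᴴ * (E μ * R μ) := by
    intro μ
    rw [hhB, hE, ← mul_assoc, ← mul_assoc, hFu, one_mul]
  have key : h μ * R μ = 1 := by
    refine eq_one_of_unitary_on_circle (h := fun w => h w * R w) (ρ := r * s) (fun i => ?_)
      (fun μ => ?_) (by positivity) ?_ ?_ μ
    · simp only [Matrix.mul_apply, Fin.sum_univ_two]
      have hRd : ∀ i j, DiffContOnCl ℂ (fun w => R w i j) (Metric.ball 0 1) := fun i j =>
        (hR i j).diffContOnCl
      exact ((hd i 0).smul (hRd 0 i)).add ((hd i 1).smul (hRd 1 i))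
    · change h μ * R μ * (h μ * R μ)ᴴ = 1
      rw [hER, Matrix.conjTranspose_mul, Matrix.conjTranspose_conjTranspose, mul_assoc,
        ← mul_assoc (E μ * R μ), hu, one_mul, hFu]
    · simp [h0, hR0]
    · simp [h0, hR0, mul_comm]
  have hFu' : F μ * (F μ)ᴴ = 1 := mul_eq_one_comm.1 (hFu μ)
  rw [hER μ] at key
  calc F μ = F μ * ((F μ)ᴴ * (E μ * R μ)) := by rw [key, mul_one]
    _ = E μ * R μ := by rw [← mul_assoc, hFu', one_mul]

end Uniqueness

/-! ### Unitarity of frames with skew-Hermitian Maurer–Cartan form -/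

section Frame

open scoped Matrix.Norms.Operator

theorem star_laxU (p q r : ℝ) (μ : Circle) : (laxU p q r μ)ᴴ = -laxU p q r μ := by
  have hc : (starRingEnd ℂ) (μ : ℂ) = (μ : ℂ)⁻¹ := by rw [← Circle.coe_inv_eq_conj, Circle.coe_inv]
  ext i j
  fin_cases i <;> fin_cases j <;> simp [laxU, hc] <;> ring

theorem star_laxV (q r : ℝ) (μ : Circle) : (laxV q r μ)ᴴ = -laxV q r μ := by
  have hc : (starRingEnd ℂ) (μ : ℂ) = (μ : ℂ)⁻¹ := by rw [← Circle.coe_inv_eq_conj, Circle.coe_inv]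
  ext i j
  fin_cases i <;> fin_cases j <;> simp [laxV, hc]

/-- The conjugate transpose, as a real continuous linear map. -/
def conjTransposeCLM : Mat2 →L[ℝ] Mat2 :=
  LinearMap.toContinuousLinearMap
    (Matrix.conjTransposeLinearEquiv (Fin 2) (Fin 2) ℝ ℂ).toLinearMap

theorem hasFDerivAt_conjTranspose {f : ℂ → Mat2} {X Y : Mat2} {z : ℂ}
    (h : HasFDerivAt f (planeDeriv X Y) z) :
    HasFDerivAt (fun z => (f z)ᴴ) (planeDeriv Xᴴ Yᴴ) z := by
  refine (conjTransposeCLM.hasFDerivAt.comp z h).congr_fderiv ?_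
  ext1 w
  change (w.re • X + w.im • Y)ᴴ = w.re • Xᴴ + w.im • Yᴴ
  simp

theorem hasFDerivAt_mul_planeDeriv {A : Type*} [NormedRing A] [NormedAlgebra ℝ A] {f g : ℂ → A}
    {X Y X' Y' : A} {z : ℂ} (hf : HasFDerivAt f (planeDeriv X Y) z)
    (hg : HasFDerivAt g (planeDeriv X' Y') z) :
    HasFDerivAt (fun z => f z * g z)
      (planeDeriv (X * g z + f z * X') (Y * g z + f z * Y')) z := by
  refine (hf.mul' hg).congr_fderiv ?_
  ext1 w
  simp only [planeDeriv_apply, add_apply, smul_apply, MulOpposite.smul_eq_mul_unop, smul_eq_mul,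
    MulOpposite.unop_op, mul_add, smul_add, mul_smul_comm, smul_mul_assoc]
  abel

theorem unitary_of_hasFDerivAt {G U V : ℂ → Mat2} (hG0 : G 0 = 1)
    (hG : ∀ z, HasFDerivAt G (planeDeriv (G z * U z) (G z * V z)) z) (hU : ∀ z, (U z)ᴴ = -U z)
    (hV : ∀ z, (V z)ᴴ = -V z) (z : ℂ) : G z * (G z)ᴴ = 1 := by
  have h : ∀ z, HasFDerivAt (fun z => G z * (G z)ᴴ) (0 : ℂ →L[ℝ] Mat2) z := by
    intro z
    refine (hasFDerivAt_mul_planeDeriv (hG z) (hasFDerivAt_conjTranspose (hG z))).congr_fderiv ?_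
    have e : ∀ X : Mat2, Xᴴ = -X → G z * X * (G z)ᴴ + G z * (G z * X)ᴴ = 0 := by
      intro X hX
      rw [Matrix.conjTranspose_mul, hX]; noncomm_ring
    rw [e _ (hU z), e _ (hV z)]
    ext1 w
    rw [planeDeriv_apply, smul_zero, smul_zero, add_zero]
    rfl
  have := is_const_of_fderiv_eq_zero (𝕜 := ℝ) (fun z => (h z).differentiableAt)
    (fun z => (h z).fderiv) z 0
  simpa [hG0] using this

end Frame

/-! ### The extended frame and the derivatives of its loop derivative -/

section Frame

open scoped Matrix.Norms.Operator

open NormedSpace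

theorem planeDeriv_add {E : Type*} [NormedAddCommGroup E] [NormedSpace ℝ E] (X Y X' Y' : E) :
    planeDeriv X Y + planeDeriv X' Y' = planeDeriv (X + X') (Y + Y') := by
  ext1 w
  simp only [planeDeriv_apply, add_apply, smul_add]
  abel

theorem loopDeriv_eq {g : MatLoop} {μ : Circle} {X : Mat2}
    (h : HasDerivAt (fun t : ℝ => g (Circle.exp t * μ)) X 0) : loopDeriv g μ = X := by
  ext i j
  exact (hasDerivAt_entry h i j).deriv

/-- The hypothesis is the `x`-part of the differential of `F' = φR + E(cS)`; multiplying it by `i`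
and subtracting the `W`-terms gives the `y`-part. In the application `S = ∂R/∂λ` and `c = iλ =
dλ/dt`. -/
theorem sym_y_part {A : Type*} [Ring A] [Algebra ℂ A] {φ E R S ξ ξ' U U' W W' : A} {c : ℂ}
    (key : (φ * ξ + E * ξ') * R + E * ξ * (c • S) = (φ * R + E * (c • S)) * U + E * R * U') :
    Complex.I • ((φ * ξ + E * ξ') * R) + φ * -(R * W)
        + (Complex.I • (E * ξ * (c • S)) + E * (c • -(S * W + R * W')))
      = (φ * R + E * (c • S)) * (Complex.I • U - W) + E * R * (Complex.I • U' - c • W') := by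
  have h := congrArg (fun X => Complex.I • X) key
  simp only [mul_add, add_mul, mul_assoc, mul_sub, mul_neg, smul_add, smul_neg, mul_smul_comm,
    smul_mul_assoc, neg_add] at h ⊢
  rw [← sub_eq_zero] at h ⊢
  rw [← h]
  abel

/-- The partial derivatives of the extended frame and of its derivative in `t`. -/
theorem IsExtendedFrame.hasFDerivAt {a b : ℝ} {p q r : ℝ → ℝ} {F : ℂ → MatLoop}
    (hF : IsExtendedFrame (normalForm a b) F) (h : IsLaxSolution a b p q r) (μ : Circle) :
    (∀ z, HasFDerivAt (fun z => F z μ)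
      (planeDeriv (F z μ * laxU (p z.im) (q z.im) (r z.im) μ)
        (F z μ * laxV (q z.im) (r z.im) μ)) z) ∧
    ∀ z, HasFDerivAt (fun z => loopDeriv (F z) μ)
      (planeDeriv
        (loopDeriv (F z) μ * laxU (p z.im) (q z.im) (r z.im) μ
          + F z μ * laxU' (q z.im) (r z.im) μ)
        (loopDeriv (F z) μ * laxV (q z.im) (r z.im) μ
          + F z μ * laxV' (q z.im) (r z.im) μ)) z := by
  have hpc : Continuous p := continuous_iff_continuousAt.2 fun y => (h.hasDerivAt_p y).continuousAt
  have hqc : Continuous q := continuous_iff_continuousAt.2 fun y => (h.hasDerivAt_q y).continuousAt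
  have hrc : Continuous r := continuous_iff_continuousAt.2 fun y => (h.hasDerivAt_r y).continuousAt
  obtain ⟨R, Rd, hR0, hRz, hRy, hRl, hRdy⟩ := exists_positiveFactor (p := p) hqc hrc
    (P := fun y => ∫ s in (0 : ℝ)..y, p s)
    (fun y => intervalIntegral.integral_hasDerivAt_right (hpc.intervalIntegrable _ _)
      (hpc.stronglyMeasurableAtFilter _ _) hpc.continuousAt) (by simp)
  have hcomm : ∀ (ν : Circle) (y : ℝ),
      laxU 0 a b ν * R ν y = R ν y * laxU (p y) (q y) (r y) ν := fun ν y =>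
    laxU_mul_eq h ν.coe_ne_zero (hR0 ν) (hRy ν) y
  have hE : ∀ (ν : Circle) (z : ℂ), HasDerivAt (fun z : ℂ => exp (z • laxU 0 a b ν))
      (exp (z • laxU 0 a b ν) * laxU 0 a b ν) z := fun ν z => hasDerivAt_exp_smul_const _ z
  have hFh : ∀ (ν : Circle) (z : ℂ),
      HasFDerivAt (fun z : ℂ => exp (z • laxU 0 a b ν) * R ν z.im)
        (planeDeriv (exp (z • laxU 0 a b ν) * R ν z.im * laxU (p z.im) (q z.im) (r z.im) ν)
          (exp (z • laxU 0 a b ν) * R ν z.im * laxV (q z.im) (r z.im) ν)) z := by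
    intro ν z
    refine (hasFDerivAt_mul_comp_im (hE ν z) (hRy ν z.im)).congr_fderiv ?_
    rw [mul_assoc (exp _), hcomm, ← laxU_sub_laxW (p z.im)]
    congr 1
    · rw [mul_assoc]
    · rw [mul_sub, mul_smul_comm, mul_neg, ← mul_assoc, ← mul_assoc, sub_eq_add_neg]
  have hFeq : ∀ (z : ℂ) (ν : Circle), F z ν = exp (z • laxU 0 a b ν) * R ν z.im := by
    intro z ν
    obtain ⟨hu, B, hB, hFB⟩ := hF z
    refine iwasawa_unique (E := fun ν : Circle => exp (z • laxU 0 a b ν))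
      (R := fun w => R w z.im) hu hB
      (fun ν => by rw [← normalForm_eq_laxU]; exact hFB ν)
      (fun i j w => (hasDerivAt_entry_complex (hRl w z.im) i j).differentiableAt)
      (Real.exp_pos _) (hRz z.im) (fun ν => ?_) ν
    exact unitary_of_hasFDerivAt (by simp [hR0]) (hFh ν) (fun z => star_laxU _ _ _ ν)
      (fun z => star_laxV _ _ ν) z
  refine ⟨fun z => by simpa only [hFeq] using hFh μ z, ?_⟩
  obtain ⟨φ, hφt, hφz⟩ := exists_hasDerivAt_exp_smul_param (contDiff_laxU_circle 0 a b μ)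
    (hasDerivAt_laxU_circle 0 a b μ)
  simp only [Circle.exp_zero, one_mul] at hφz
  have hRt : ∀ y : ℝ, HasDerivAt (fun t : ℝ => R (Circle.exp t * μ : Circle) y)
      ((Complex.I * μ) • Rd μ y) 0 := by
    intro y
    have h1 : HasDerivAt (fun w => R w y) (Rd μ y) ((Circle.exp (0 : ℝ) * μ : Circle) : ℂ) := by
      simpa using hRl μ y
    exact h1.scomp (0 : ℝ) (hasDerivAt_circleExp_mul μ)
  have hloop : ∀ z, loopDeriv (F z) μ
      = φ z * R μ z.im + exp (z • laxU 0 a b μ) * ((Complex.I * μ) • Rd μ z.im) := by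
    intro z
    refine loopDeriv_eq ?_
    simp only [hFeq]
    refine ((hφt z).fun_mul (hRt z.im)).congr_deriv ?_
    simp only [Circle.exp_zero, one_mul]
    rfl
  -- The relation `ξR = RU` holds for all `λ` on the circle, so it may be differentiated in `t`.
  have hdcomm : ∀ y, laxU' a b μ * R μ y + laxU 0 a b μ * ((Complex.I * μ) • Rd μ y)
      = ((Complex.I * μ) • Rd μ y) * laxU (p y) (q y) (r y) μ
        + R μ y * laxU' (q y) (r y) μ := by
    intro y
    have h1 := (hasDerivAt_laxU_circle 0 a b μ).fun_mul (hRt y)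
    have h2 := (hRt y).fun_mul (hasDerivAt_laxU_circle (p y) (q y) (r y) μ)
    simp only [hcomm] at h1
    simpa using h1.unique h2
  intro z
  have hd := (hasFDerivAt_mul_comp_im (hφz z) (hRy μ z.im)).fun_add
    (hasFDerivAt_mul_comp_im (R := fun y => (Complex.I * μ) • Rd μ y) (hE μ z)
      ((hRdy μ z.im).fun_const_smul (Complex.I * (μ : ℂ))))
  simp only [hloop, hFeq]
  refine hd.congr_fderiv ?_
  have key : (φ z * laxU 0 a b μ + exp (z • laxU 0 a b μ) * laxU' a b μ) * R μ z.im
      + exp (z • laxU 0 a b μ) * laxU 0 a b μ * ((Complex.I * μ) • Rd μ z.im)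
      = (φ z * R μ z.im + exp (z • laxU 0 a b μ) * ((Complex.I * μ) • Rd μ z.im))
          * laxU (p z.im) (q z.im) (r z.im) μ
        + exp (z • laxU 0 a b μ) * R μ z.im * laxU' (q z.im) (r z.im) μ := by
    have := congrArg (fun X => exp (z • laxU 0 a b μ) * X) (hdcomm z.im)
    simp only [mul_add, add_mul, mul_assoc] at this ⊢
    rw [add_assoc, this, hcomm]
    abel
  rw [planeDeriv_add, ← laxU_sub_laxW (p z.im), ← laxU'_sub_laxW']
  exact congrArg₂ planeDeriv key (sym_y_part key)

end Frame

/-! ### Invariants of a surface from an adapted moving frame -/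

section Surface

open scoped Matrix.Norms.Operator

/-- Membership in `su(2)`. -/
structure IsSu2 (X : Mat2) : Prop where
  star_eq : Xᴴ = -X
  trace_eq : X.trace = 0

theorem IsSu2.conj {X G : Mat2} (hX : IsSu2 X) (hG : Gᴴ * G = 1) : IsSu2 (G * X * Gᴴ) := by
  refine ⟨?_, ?_⟩
  · simp [Matrix.conjTranspose_mul, hX.star_eq, mul_assoc]
  · rw [Matrix.trace_mul_comm, ← mul_assoc, hG, one_mul, hX.trace_eq]

theorem IsSu2.commutator {X Y : Mat2} (hX : IsSu2 X) (hY : IsSu2 Y) : IsSu2 (X * Y - Y * X) := by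
  refine ⟨?_, ?_⟩
  · simp [Matrix.conjTranspose_mul, hX.star_eq, hY.star_eq]
  · rw [Matrix.trace_sub, Matrix.trace_mul_comm, sub_self]

/-- `toR3` as a continuous linear map. -/
def toR3CLM : Mat2 →L[ℝ] (Fin 3 → ℝ) :=
  LinearMap.toContinuousLinearMap
    { toFun := toR3
      map_add' := fun X Y => by
        ext i
        fin_cases i <;> simp [toR3, mul_add]
      map_smul' := fun c X => by
        ext i
        fin_cases i <;> simp [toR3] <;> ring }

theorem toR3_smul (c : ℝ) (X : Mat2) : toR3 (c • X) = c • toR3 X := toR3CLM.map_smul c X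

theorem toR3_add (X Y : Mat2) : toR3 (X + Y) = toR3 X + toR3 Y := toR3CLM.map_add X Y

theorem toR3_conj_dotProduct {X Y G : Mat2} (hX : IsSu2 X) (hY : IsSu2 Y) (hG : Gᴴ * G = 1)
    {c : ℝ} (h : -2 * (X * Y).trace = c) :
    toR3 (G * X * Gᴴ) ⬝ᵥ toR3 (G * Y * Gᴴ) = c := by
  have hX' := hX.conj hG
  have hY' := hY.conj hG
  have h1 := toR3_dotProduct _ _ hX'.star_eq hY'.star_eq hX'.trace_eq hY'.trace_eq
  have h2 : G * X * Gᴴ * (G * Y * Gᴴ) = G * (X * Y) * Gᴴ := by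
    calc _ = G * X * (Gᴴ * G) * Y * Gᴴ := by simp only [mul_assoc]
      _ = _ := by rw [hG, mul_one]; simp only [mul_assoc]
  rw [h2, Matrix.trace_mul_comm, ← mul_assoc, hG, one_mul, h] at h1
  exact_mod_cast h1

theorem toR3_conj_cross {X Y G : Mat2} (hX : IsSu2 X) (hY : IsSu2 Y) (hG : Gᴴ * G = 1) :
    toR3 (G * X * Gᴴ) ⨯₃ toR3 (G * Y * Gᴴ) = toR3 (G * (X * Y - Y * X) * Gᴴ) := by
  have hX' := hX.conj hG
  have hY' := hY.conj hG
  rw [← toR3_bracket _ _ hX'.star_eq hY'.star_eq hX'.trace_eq hY'.trace_eq]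
  have h2 : ∀ X Y : Mat2, G * X * Gᴴ * (G * Y * Gᴴ) = G * (X * Y) * Gᴴ := by
    intro X Y
    calc _ = G * X * (Gᴴ * G) * Y * Gᴴ := by simp only [mul_assoc]
      _ = _ := by rw [hG, mul_one]; simp only [mul_assoc]
  rw [h2, h2, ← sub_mul, ← mul_sub]

/-- A frame of the `z`-plane: `F⁻¹ dF = U(y) dx + V(y) dy`. -/
structure IsFrame (F : ℂ → Mat2) (U V : ℝ → Mat2) : Prop where
  unitary : ∀ z, (F z)ᴴ * F z = 1
  hasFDerivAt : ∀ z, HasFDerivAt F (planeDeriv (F z * U z.im) (F z * V z.im)) z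
  su2_U : ∀ y, IsSu2 (U y)
  su2_V : ∀ y, IsSu2 (V y)
  contDiff_U : ContDiff ℝ ∞ U
  contDiff_V : ContDiff ℝ ∞ V

/-- Bootstrapping: the partial derivatives `FU` and `FV` are as smooth as `F` itself. -/
theorem IsFrame.contDiff {F : ℂ → Mat2} {U V : ℝ → Mat2} (h : IsFrame F U V) :
    ContDiff ℝ ∞ F := by
  rw [contDiff_infty]
  intro n
  induction n with
  | zero =>
    rw [Nat.cast_zero, contDiff_zero]
    exact continuous_iff_continuousAt.2 fun z => (h.hasFDerivAt z).continuousAt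
  | succ n ih =>
    have hU : ContDiff ℝ n fun z : ℂ => U z.im :=
      (contDiff_infty.1 h.contDiff_U n).comp Complex.imCLM.contDiff
    have hV : ContDiff ℝ n fun z : ℂ => V z.im :=
      (contDiff_infty.1 h.contDiff_V n).comp Complex.imCLM.contDiff
    exact_mod_cast contDiff_of_hasFDerivAt_planeDeriv h.hasFDerivAt (ih.mul hU) (ih.mul hV)

theorem hasFDerivAt_comp_im {E : Type*} [NormedAddCommGroup E] [NormedSpace ℝ E] {X : ℝ → E}
    {X' : E} {z : ℂ} (h : HasDerivAt X X' z.im) :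
    HasFDerivAt (fun z : ℂ => X z.im) (planeDeriv 0 X') z := by
  refine (h.hasFDerivAt.comp z Complex.imCLM.hasFDerivAt).congr_fderiv ?_
  ext1 w
  simp

theorem IsFrame.hasFDerivAt_conj {F : ℂ → Mat2} {U V : ℝ → Mat2} (h : IsFrame F U V)
    {X : ℝ → Mat2} {X' : Mat2} {z : ℂ} (hX : HasDerivAt X X' z.im) :
    HasFDerivAt (fun z => F z * X z.im * (F z)ᴴ)
      (planeDeriv (F z * (U z.im * X z.im - X z.im * U z.im) * (F z)ᴴ)
        (F z * (V z.im * X z.im - X z.im * V z.im + X') * (F z)ᴴ)) z := by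
  refine (hasFDerivAt_mul_planeDeriv (hasFDerivAt_mul_planeDeriv (h.hasFDerivAt z)
    (hasFDerivAt_comp_im hX)) (hasFDerivAt_conjTranspose (h.hasFDerivAt z))).congr_fderiv ?_
  rw [Matrix.conjTranspose_mul, Matrix.conjTranspose_mul, (h.su2_U _).star_eq,
    (h.su2_V _).star_eq]
  congr 1 <;> noncomm_ring

theorem hasFDerivAt_toR3 {f : ℂ → Mat2} {X Y : Mat2} {z : ℂ}
    (h : HasFDerivAt f (planeDeriv X Y) z) :
    HasFDerivAt (fun z => toR3 (f z)) (planeDeriv (toR3 X) (toR3 Y)) z := by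
  refine (toR3CLM.hasFDerivAt.comp z h).congr_fderiv ?_
  ext1 w
  change toR3 (w.re • X + w.im • Y) = w.re • toR3 X + w.im • toR3 Y
  rw [toR3_add, toR3_smul, toR3_smul]

theorem dirDeriv_eq {f : ℂ → Fin 3 → ℝ} {X Y : Fin 3 → ℝ} {z : ℂ}
    (h : HasFDerivAt f (planeDeriv X Y) z) (w : ℂ) :
    dirDeriv f w z = w.re • X + w.im • Y := by
  rw [dirDeriv, h.fderiv, planeDeriv_apply]

/-- Conjugation by a unitary `F` preserves inner and cross products, so everything reduces to traces
in `su(2)`. Up to the factor `v`, the coefficients of the second fundamental form are `L = ⟨[U, A],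
N⟩`, `M = ⟨[U, B], N⟩`, `K = ⟨[V, B], N⟩`. -/
theorem hasSurfaceInvariants_of_isFrame {F : ℂ → Mat2} {U V : ℝ → Mat2} (h : IsFrame F U V)
    {f : ℂ → Fin 3 → ℝ} {v v' L M K : ℝ → ℝ} {A B N : Mat2} {H : ℝ} {c : ℂ}
    (hv : ∀ y, HasDerivAt v (v' y) y) (hvs : ContDiff ℝ ∞ v) (hv0 : ∀ y, v y ≠ 0)
    (hA : IsSu2 A) (hB : IsSu2 B) (hN : A * B - B * A = N)
    (hAA : -2 * (A * A).trace = (1 : ℝ)) (hBB : -2 * (B * B).trace = (1 : ℝ))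
    (hAB : -2 * (A * B).trace = (0 : ℝ))
    (hf : ∀ z, HasFDerivAt f (planeDeriv (toR3 (F z * (v z.im • A) * (F z)ᴴ))
      (toR3 (F z * (v z.im • B) * (F z)ᴴ))) z)
    (hL : ∀ y, -2 * ((U y * A - A * U y) * N).trace = (L y : ℝ))
    (hM : ∀ y, -2 * ((U y * B - B * U y) * N).trace = (M y : ℝ))
    (hK : ∀ y, -2 * ((V y * B - B * V y) * N).trace = (K y : ℝ))
    (hH : ∀ y, L y + K y = 2 * v y * H)
    (hc : ∀ y, (v y : ℂ) * ((L y : ℂ) - K y - 2 * Complex.I * M y) / 4 = c) :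
    HasSurfaceInvariants f (fun z => v z.im) H c := by
  have hNsu : IsSu2 N := hN ▸ hA.commutator hB
  set α : ℂ → Fin 3 → ℝ := fun z => toR3 (F z * A * (F z)ᴴ)
  set β : ℂ → Fin 3 → ℝ := fun z => toR3 (F z * B * (F z)ᴴ)
  set n : ℂ → Fin 3 → ℝ := fun z => toR3 (F z * N * (F z)ᴴ)
  have hαα : ∀ z, α z ⬝ᵥ α z = 1 := fun z => toR3_conj_dotProduct hA hA (h.unitary z) hAA
  have hββ : ∀ z, β z ⬝ᵥ β z = 1 := fun z => toR3_conj_dotProduct hB hB (h.unitary z) hBB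
  have hαβ : ∀ z, α z ⬝ᵥ β z = 0 := fun z => toR3_conj_dotProduct hA hB (h.unitary z) hAB
  have hn : ∀ z, α z ⨯₃ β z = n z := fun z => by
    simp only [n, ← hN]; exact toR3_conj_cross hA hB (h.unitary z)
  have hnn : ∀ z, n z ⬝ᵥ n z = 1 := fun z => by
    rw [← hn, cross_dot_cross, hαα, hββ, hαβ]; ring
  have hβn : ∀ z, β z ⬝ᵥ n z = 0 := fun z => by
    rw [← hn, dot_cross_self]
  have hsm : ∀ (z : ℂ) (X : Mat2),
      toR3 (F z * (v z.im • X) * (F z)ᴴ) = v z.im • toR3 (F z * X * (F z)ᴴ) := by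
    intro z X
    rw [mul_smul_comm, smul_mul_assoc, toR3_smul]
  have hf1 : dirDeriv f 1 = fun z => toR3 (F z * (v z.im • A) * (F z)ᴴ) :=
    funext fun z => by simp [dirDeriv_eq (hf z)]
  have hfI : dirDeriv f Complex.I = fun z => toR3 (F z * (v z.im • B) * (F z)ᴴ) :=
    funext fun z => by simp [dirDeriv_eq (hf z)]
  have hconj : ∀ (z : ℂ) (X : Mat2), HasFDerivAt (fun z => toR3 (F z * (v z.im • X) * (F z)ᴴ))
      (planeDeriv (v z.im • toR3 (F z * (U z.im * X - X * U z.im) * (F z)ᴴ))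
        (v z.im • toR3 (F z * (V z.im * X - X * V z.im) * (F z)ᴴ)
          + v' z.im • toR3 (F z * X * (F z)ᴴ))) z := by
    intro z X
    have h1 := hasFDerivAt_toR3 (h.hasFDerivAt_conj ((hv z.im).smul_const X))
    refine h1.congr_fderiv ?_
    have e : ∀ Y : Mat2, Y * v z.im • X - v z.im • X * Y = v z.im • (Y * X - X * Y) := by
      intro Y
      rw [mul_smul_comm, smul_mul_assoc, smul_sub]
    rw [e, e, hsm, mul_add, add_mul, toR3_add, hsm, mul_smul_comm, smul_mul_assoc, toR3_smul]
  -- The cross product carries the factor `v²`, so the normal does not depend on the sign of `v`.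
  have hnormal : ∀ z, unitNormal f z = n z := by
    intro z
    have h2 : dirDeriv f 1 z ⨯₃ dirDeriv f Complex.I z = (v z.im ^ 2) • n z := by
      rw [hf1, hfI]
      simp only [hsm]
      rw [map_smul, map_smul, LinearMap.smul_apply, smul_smul, ← hn, pow_two]
    simp only [unitNormal, h2]
    have h3 : (v z.im ^ 2 • n z) ⬝ᵥ (v z.im ^ 2 • n z) = (v z.im ^ 2) ^ 2 := by
      rw [smul_dotProduct, dotProduct_smul, hnn]; simp; ring
    rw [h3, Real.sqrt_sq (sq_nonneg _), smul_smul, inv_mul_cancel₀ (pow_ne_zero 2 (hv0 _)),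
      one_smul]
  have s11 : ∀ z, secondForm f z 1 1 = v z.im * L z.im := by
    intro z
    rw [secondForm, hf1, dirDeriv_eq (hconj z A), hnormal]
    have := toR3_conj_dotProduct ((h.su2_U z.im).commutator hA) hNsu (h.unitary z) (hL z.im)
    simp [n, smul_dotProduct, this]
  have s1I : ∀ z, secondForm f z 1 Complex.I = v z.im * M z.im := by
    intro z
    rw [secondForm, hfI, dirDeriv_eq (hconj z B), hnormal]
    have := toR3_conj_dotProduct ((h.su2_U z.im).commutator hB) hNsu (h.unitary z) (hM z.im)
    simp [n, smul_dotProduct, this]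
  -- The additional term `v' F B F*` is tangential and drops out.
  have sII : ∀ z, secondForm f z Complex.I Complex.I = v z.im * K z.im := by
    intro z
    rw [secondForm, hfI, dirDeriv_eq (hconj z B), hnormal]
    have := toR3_conj_dotProduct ((h.su2_V z.im).commutator hB) hNsu (h.unitary z) (hK z.im)
    have h2 := hβn z
    simp only [β, n] at h2
    simp [n, smul_dotProduct, add_dotProduct, this, h2]
  have hmetric : ∀ z u w, firstForm f z u w = v z.im ^ 2 * (u * (starRingEnd ℂ) w).re := by
    intro z u w
    have h1 := hαα z
    have h2 := hββ z
    have h3 := hαβ z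
    have h4 : β z ⬝ᵥ α z = 0 := by rw [dotProduct_comm, h3]
    simp only [α, β] at h1 h2 h3 h4
    rw [firstForm, dirDeriv_eq (hf z), dirDeriv_eq (hf z)]
    simp only [hsm, smul_dotProduct, dotProduct_smul, add_dotProduct, dotProduct_add, h1, h2, h3,
      h4, smul_eq_mul, Complex.mul_re, Complex.conj_re, Complex.conj_im]
    ring
  refine ⟨?_, fun z => ?_, hmetric, fun z => ?_, fun z => ?_⟩
  · rw [contDiff_infty]
    intro m
    have hF := contDiff_infty.1 h.contDiff m
    have hvm : ContDiff ℝ m fun z : ℂ => v z.im :=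
      (contDiff_infty.1 hvs m).comp Complex.imCLM.contDiff
    have hX : ∀ X : Mat2, ContDiff ℝ m fun z => toR3 (F z * (v z.im • X) * (F z)ᴴ) := fun X =>
      toR3CLM.contDiff.comp ((hF.mul (hvm.smul contDiff_const)).mul
        (conjTransposeCLM.contDiff.comp hF))
    exact (contDiff_of_hasFDerivAt_planeDeriv hf (hX A) (hX B)).of_le (by exact_mod_cast le_self_add)
  · refine (injective_iff_map_eq_zero _).2 fun w hw => ?_
    have h1 := hmetric z w w
    rw [firstForm, dirDeriv, hw, zero_dotProduct, Complex.mul_conj, Complex.ofReal_re] at h1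
    have := (mul_eq_zero.1 h1.symm).resolve_left (pow_ne_zero 2 (hv0 _))
    exact Complex.normSq_eq_zero.1 this
  · have hvz := hv0 z.im
    rw [meanCurvature, s11, s1I, sII, hmetric, hmetric, hmetric]
    simp
    field_simp
    linarith [hH z.im]
  · rw [hopfCoeff, s11, s1I, sII, ← hc z.im]
    push_cast
    ring

end Surface

/-! ### The Sym–Bobenko surfaces and their fundamental forms -/

section SymBobenko

open scoped Matrix.Norms.Operator

theorem IsLaxSolution.contDiff {a b : ℝ} {p q r : ℝ → ℝ} (h : IsLaxSolution a b p q r) :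
    ContDiff ℝ ∞ p ∧ ContDiff ℝ ∞ q ∧ ContDiff ℝ ∞ r := by
  have succ : ∀ {f f' : ℝ → ℝ} {n : ℕ}, (∀ y, HasDerivAt f (f' y) y) → ContDiff ℝ n f' →
      ContDiff ℝ (n + 1 : ℕ) f := by
    intro f f' n hf hf'
    have e : deriv f = f' := funext fun y => (hf y).deriv
    rw [Nat.cast_add, Nat.cast_one, contDiff_succ_iff_deriv]
    exact ⟨fun y => (hf y).differentiableAt, by simp, e ▸ hf'⟩
  have key : ∀ n : ℕ, ContDiff ℝ n p ∧ ContDiff ℝ n q ∧ ContDiff ℝ n r := by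
    intro n
    induction n with
    | zero =>
      simp only [Nat.cast_zero, contDiff_zero]
      exact ⟨continuous_iff_continuousAt.2 fun y => (h.hasDerivAt_p y).continuousAt,
        continuous_iff_continuousAt.2 fun y => (h.hasDerivAt_q y).continuousAt,
        continuous_iff_continuousAt.2 fun y => (h.hasDerivAt_r y).continuousAt⟩
    | succ n ih =>
      obtain ⟨hp, hq, hr⟩ := ih
      exact ⟨succ h.hasDerivAt_p (by fun_prop), succ h.hasDerivAt_q (by fun_prop),
        succ h.hasDerivAt_r (by fun_prop)⟩
  simp only [contDiff_infty]
  exact ⟨fun n => (key n).1, fun n => (key n).2.1, fun n => (key n).2.2⟩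

theorem IsLaxSolution.mul_eq {a b : ℝ} {p q r : ℝ → ℝ} (h : IsLaxSolution a b p q r) (y : ℝ) :
    q y * r y = a * b := by
  have hd : ∀ y, HasDerivAt (fun y => q y * r y) 0 y := fun y =>
    ((h.hasDerivAt_q y).fun_mul (h.hasDerivAt_r y)).congr_deriv (by ring)
  have := is_const_of_deriv_eq_zero (fun y => (hd y).differentiableAt) (fun y => (hd y).deriv) y 0
  simpa [h.q_zero, h.r_zero] using this

theorem isSu2_laxU (p q r : ℝ) (μ : Circle) : IsSu2 (laxU p q r μ) :=
  ⟨star_laxU p q r μ, by simp [laxU, Matrix.trace_fin_two]⟩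

theorem isSu2_laxV (q r : ℝ) (μ : Circle) : IsSu2 (laxV q r μ) :=
  ⟨star_laxV q r μ, by simp [laxV, Matrix.trace_fin_two]⟩

variable {a b : ℝ} {p q r : ℝ → ℝ} {F : ℂ → MatLoop}

theorem IsExtendedFrame.isFrame (hF : IsExtendedFrame (normalForm a b) F)
    (h : IsLaxSolution a b p q r) (μ : Circle) :
    IsFrame (fun z => F z μ) (fun y => laxU (p y) (q y) (r y) μ)
      (fun y => laxV (q y) (r y) μ) := by
  obtain ⟨hp, hq, hr⟩ := h.contDiff
  have hp' : ContDiff ℝ ∞ fun y => (p y : ℂ) := Complex.ofRealCLM.contDiff.comp hp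
  have hq' : ContDiff ℝ ∞ fun y => (q y : ℂ) := Complex.ofRealCLM.contDiff.comp hq
  have hr' : ContDiff ℝ ∞ fun y => (r y : ℂ) := Complex.ofRealCLM.contDiff.comp hr
  refine ⟨fun z => ?_, (hF.hasFDerivAt h μ).1, fun y => isSu2_laxU _ _ _ μ,
    fun y => isSu2_laxV _ _ μ, ?_, ?_⟩
  · exact Matrix.mem_unitaryGroup_iff'.1 (Matrix.mem_specialUnitaryGroup_iff.1 ((hF z).1.mem μ)).1
  · refine contDiff_mat fun i j => ?_
    fin_cases i <;> fin_cases j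
    · exact contDiff_const.mul hp'
    · exact contDiff_const.mul ((hq'.mul contDiff_const).add (hr'.mul contDiff_const))
    · exact contDiff_const.mul ((hr'.mul contDiff_const).add (hq'.mul contDiff_const))
    · exact contDiff_const.mul hp'.neg
  · refine contDiff_mat fun i j => ?_
    fin_cases i <;> fin_cases j
    · exact contDiff_const (c := (0 : ℂ))
    · exact (hr'.mul contDiff_const).sub (hq'.mul contDiff_const)
    · exact (hq'.mul contDiff_const).sub (hr'.mul contDiff_const)
    · exact contDiff_const (c := (0 : ℂ))

theorem smul_planeDeriv {E : Type*} [NormedAddCommGroup E] [NormedSpace ℝ E] (c : ℝ) (X Y : E) :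
    c • planeDeriv X Y = planeDeriv (c • X) (c • Y) := by
  ext1 w
  rw [smul_apply, planeDeriv_apply, planeDeriv_apply, smul_add, smul_comm c, smul_comm c]

/-- The partial derivatives of the surfaces given by the Sym--Bobenko formula. -/
theorem IsExtendedFrame.hasFDerivAt_symBobenko (hF : IsExtendedFrame (normalForm a b) F)
    (h : IsLaxSolution a b p q r) (μ : Circle) (H s : ℝ) {X Y : ℝ → Mat2}
    (hX : ∀ y, (-(1 / (2 * H))) • (laxU (p y) (q y) (r y) μ * ((-s) • e1)
      - ((-s) • e1) * laxU (p y) (q y) (r y) μ + laxU' (q y) (r y) μ) = X y)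
    (hY : ∀ y, (-(1 / (2 * H))) • (laxV (q y) (r y) μ * ((-s) • e1)
      - ((-s) • e1) * laxV (q y) (r y) μ + laxV' (q y) (r y) μ) = Y y) (z : ℂ) :
    HasFDerivAt (symBobenko H s F μ) (planeDeriv (toR3 (F z μ * X z.im * (F z μ)ᴴ))
      (toR3 (F z μ * Y z.im * (F z μ)ᴴ))) z := by
  have hfr := hF.isFrame h μ
  have hinv : ∀ z, (F z μ)⁻¹ = (F z μ)ᴴ := fun z => Matrix.inv_eq_left_inv (hfr.unitary z)
  have h1 := hfr.hasFDerivAt_conj (z := z) (hasDerivAt_const z.im ((-s) • e1))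
  have h2 := hasFDerivAt_mul_planeDeriv ((hF.hasFDerivAt h μ).2 z)
    (hasFDerivAt_conjTranspose (hfr.hasFDerivAt z))
  have h3 := hasFDerivAt_toR3 (((h1.fun_add h2).fun_const_smul (-(1 / (2 * H)))).congr_fderiv
    (g' := planeDeriv (F z μ * X z.im * (F z μ)ᴴ) (F z μ * Y z.im * (F z μ)ᴴ)) ?_)
  · have e : symBobenko H s F μ = fun z => toR3 ((-(1 / (2 * H))) •
        (F z μ * ((-s) • e1) * (F z μ)ᴴ + loopDeriv (F z) μ * (F z μ)ᴴ)) := by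
      funext z
      rw [symBobenko, euclideanAction, hinv]
    rw [e]
    exact h3
  -- In the derivative of `F'F*` the terms `F'SF*` cancel because `S` is skew-Hermitian; only the
  -- `t`-derivative `S'` of the Maurer–Cartan form remains.
  · have e : ∀ S S' : Mat2, Sᴴ = -S →
        F z μ * (S * ((-s) • e1) - ((-s) • e1) * S) * (F z μ)ᴴ
          + ((loopDeriv (F z) μ * S + F z μ * S') * (F z μ)ᴴ + loopDeriv (F z) μ * (F z μ * S)ᴴ)
        = F z μ * (S * ((-s) • e1) - ((-s) • e1) * S + S') * (F z μ)ᴴ := by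
      intro S S' hS
      rw [Matrix.conjTranspose_mul, hS]
      generalize (-s) • e1 = η
      noncomm_ring
    rw [planeDeriv_add, add_zero, e _ _ (hfr.su2_U _).star_eq, e _ _ (hfr.su2_V _).star_eq,
      ← hX, ← hY, smul_planeDeriv]
    simp only [mul_smul_comm, smul_mul_assoc]

/-- On the circle conjugation is inversion, which makes the trace identities rational in `λ`. -/
theorem coe_re_sq (μ : Circle) :
    ((((μ : ℂ) ^ 2).re : ℝ) : ℂ) = ((μ : ℂ) ^ 2 + ((μ : ℂ)⁻¹) ^ 2) / 2 := by
  rw [Complex.re_eq_add_conj, map_pow, ← Circle.coe_inv_eq_conj, Circle.coe_inv]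

theorem coe_im_sq (μ : Circle) :
    ((((μ : ℂ) ^ 2).im : ℝ) : ℂ) = -Complex.I * ((μ : ℂ) ^ 2 - ((μ : ℂ)⁻¹) ^ 2) / 2 := by
  rw [Complex.im_eq_sub_conj, map_pow, ← Circle.coe_inv_eq_conj, Circle.coe_inv]
  field_simp
  rw [Complex.I_sq]
  ring

/-- The frame vectors `A`, `B` tangent to the surfaces `f⁺` (`ε = 1`, `ν = λ`) and `f⁻`
(`ε = -1`, `ν = λ⁻¹`). -/
def tangentA (ε : ℝ) (ν : Circle) : Mat2 :=
  !![0, ε * (ν : ℂ) / 2; -(ε * (ν : ℂ)⁻¹) / 2, 0]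

/-- See `tangentA`. -/
def tangentB (ν : Circle) : Mat2 :=
  !![0, -(Complex.I * ν) / 2; -(Complex.I * (ν : ℂ)⁻¹) / 2, 0]

theorem isSu2_tangentA (ε : ℝ) (ν : Circle) : IsSu2 (tangentA ε ν) := by
  have hc : (starRingEnd ℂ) (ν : ℂ) = (ν : ℂ)⁻¹ := by rw [← Circle.coe_inv_eq_conj, Circle.coe_inv]
  refine ⟨?_, by simp [Matrix.trace_fin_two, tangentA]⟩
  ext i j
  fin_cases i <;> fin_cases j <;> simp [hc, tangentA] <;> ring

theorem isSu2_tangentB (ν : Circle) : IsSu2 (tangentB ν) := by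
  have hc : (starRingEnd ℂ) (ν : ℂ) = (ν : ℂ)⁻¹ := by rw [← Circle.coe_inv_eq_conj, Circle.coe_inv]
  refine ⟨?_, by simp [Matrix.trace_fin_two, tangentB]⟩
  ext i j
  fin_cases i <;> fin_cases j <;> simp [hc, tangentB] <;> ring

/-- With `ε = s`, the unit normal is the conjugate by `F` of the same vector `-s e₁` that enters the
Sym–Bobenko formula. -/
theorem tangent_commutator (ε : ℝ) (ν : Circle) :
    tangentA ε ν * tangentB ν - tangentB ν * tangentA ε ν = (-ε) • e1 := by
  have hν := ν.coe_ne_zero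
  ext i j
  fin_cases i <;> fin_cases j <;> simp [tangentA, tangentB, e1] <;> field_simp <;> ring

theorem trace_tangentA_mul_self {ε : ℝ} (hε : ε ^ 2 = 1) (ν : Circle) :
    -2 * (tangentA ε ν * tangentA ε ν).trace = (1 : ℝ) := by
  have hν := ν.coe_ne_zero
  have hε' : (ε : ℂ) ^ 2 = 1 := by exact_mod_cast hε
  simp [tangentA, Matrix.trace_fin_two]
  field_simp
  linear_combination hε' * 2

theorem trace_tangentB_mul_self (ν : Circle) :
    -2 * (tangentB ν * tangentB ν).trace = (1 : ℝ) := by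
  have hν := ν.coe_ne_zero
  simp [tangentB, Matrix.trace_fin_two]
  field_simp
  rw [Complex.I_sq]
  ring

theorem trace_tangentA_mul_tangentB (ε : ℝ) (ν : Circle) :
    -2 * (tangentA ε ν * tangentB ν).trace = (0 : ℝ) := by
  have hν := ν.coe_ne_zero
  simp [tangentA, tangentB, Matrix.trace_fin_two]
  field_simp
  ring

/-- The diagonal entry `p` commutes with `e₁`; between the commutator and `U'` the `q`-terms cancel
and the `r`-terms double. For the opposite sign of `e₁` the roles of `q` and `r` are exchanged. -/
theorem sym_dx_pos (p q r : ℝ) (μ : Circle) {H : ℝ} (hH : H ≠ 0) :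
    (-(1 / (2 * H))) • (laxU p q r μ * ((-(1 : ℝ)) • e1)
      - ((-(1 : ℝ)) • e1) * laxU p q r μ + laxU' q r μ)
      = (2 * r * H⁻¹) • tangentA 1 μ := by
  have hμ := μ.coe_ne_zero
  have hI := Complex.I_mul_I
  have hHc : (H : ℂ) ≠ 0 := Complex.ofReal_ne_zero.2 hH
  ext i j
  fin_cases i <;> fin_cases j <;> simp [laxU, laxU', e1, tangentA] <;> field_simp <;> grind

theorem sym_dy_pos (q r : ℝ) (μ : Circle) {H : ℝ} (hH : H ≠ 0) :
    (-(1 / (2 * H))) • (laxV q r μ * ((-(1 : ℝ)) • e1)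
      - ((-(1 : ℝ)) • e1) * laxV q r μ + laxV' q r μ)
      = (2 * r * H⁻¹) • tangentB μ := by
  have hμ := μ.coe_ne_zero
  have hI := Complex.I_mul_I
  have hHc : (H : ℂ) ≠ 0 := Complex.ofReal_ne_zero.2 hH
  ext i j
  fin_cases i <;> fin_cases j <;> simp [laxV, laxV', e1, tangentB] <;> field_simp <;> grind

theorem trace_dxx_pos (p q r : ℝ) (μ : Circle) :
    -2 * ((laxU p q r μ * tangentA 1 μ
      - tangentA 1 μ * laxU p q r μ) * ((-(1 : ℝ)) • e1)).trace
      = ((2 * r + 2 * q * ((μ : ℂ) ^ 2).re : ℝ) : ℂ) := by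
  have hμ := μ.coe_ne_zero
  have hI := Complex.I_mul_I
  push_cast
  rw [coe_re_sq]
  simp [Matrix.trace_fin_two, laxU, tangentA, e1]
  field_simp
  grind

theorem trace_dxy_pos (p q r : ℝ) (μ : Circle) :
    -2 * ((laxU p q r μ * tangentB μ
      - tangentB μ * laxU p q r μ) * ((-(1 : ℝ)) • e1)).trace
      = ((2 * q * ((μ : ℂ) ^ 2).im : ℝ) : ℂ) := by
  have hμ := μ.coe_ne_zero
  have hI := Complex.I_mul_I
  push_cast
  rw [coe_im_sq]
  simp [Matrix.trace_fin_two, laxU, tangentB, e1]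
  field_simp
  grind

theorem trace_dyy_pos (q r : ℝ) (μ : Circle) :
    -2 * ((laxV q r μ * tangentB μ
      - tangentB μ * laxV q r μ) * ((-(1 : ℝ)) • e1)).trace
      = ((2 * r - 2 * q * ((μ : ℂ) ^ 2).re : ℝ) : ℂ) := by
  have hμ := μ.coe_ne_zero
  have hI := Complex.I_mul_I
  push_cast
  rw [coe_re_sq]
  simp [Matrix.trace_fin_two, laxV, tangentB, e1]
  field_simp
  grind

/-- The surface `f⁺`. -/
theorem hasSurfaceInvariants_symBobenko_pos (hF : IsExtendedFrame (normalForm a b) F)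
    (h : IsLaxSolution a b p q r) (μ : Circle) {H : ℝ} (hH : H ≠ 0) (hr : ∀ y, r y ≠ 0) :
    HasSurfaceInvariants (symBobenko H 1 F μ) (fun z => 2 * r z.im * H⁻¹) H
      (((μ : ℂ) ^ 2)⁻¹ * ((2 * a * b * H⁻¹ : ℝ) : ℂ)) := by
  have hμ := μ.coe_ne_zero
  have hHc : (H : ℂ) ≠ 0 := Complex.ofReal_ne_zero.2 hH
  have hv : ∀ y, HasDerivAt (fun y => 2 * r y * H⁻¹) (2 * (2 * p y * r y) * H⁻¹) y :=
    fun y => ((h.hasDerivAt_r y).const_mul 2).mul_const _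
  have hvs : ContDiff ℝ ∞ fun y => 2 * r y * H⁻¹ :=
    (contDiff_const.mul h.contDiff.2.2).mul contDiff_const
  have hv0 : ∀ y, 2 * r y * H⁻¹ ≠ 0 := fun y =>
    mul_ne_zero (mul_ne_zero two_ne_zero (hr y)) (inv_ne_zero hH)
  have hd := hF.hasFDerivAt_symBobenko h μ H 1
    (X := fun y => (2 * r y * H⁻¹) • tangentA 1 μ)
    (Y := fun y => (2 * r y * H⁻¹) • tangentB μ)
    (fun y => sym_dx_pos (p y) (q y) (r y) μ hH) (fun y => sym_dy_pos (q y) (r y) μ hH)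
  have hqr : ∀ y, (q y : ℂ) * r y = a * b := fun y => by exact_mod_cast h.mul_eq y
  refine hasSurfaceInvariants_of_isFrame (hF.isFrame h μ) hv hvs hv0 (isSu2_tangentA 1 μ)
    (isSu2_tangentB μ) (tangent_commutator 1 μ) (trace_tangentA_mul_self (by norm_num) _)
    (trace_tangentB_mul_self _) (trace_tangentA_mul_tangentB _ _) hd
    (L := fun y => 2 * r y + 2 * q y * ((μ : ℂ) ^ 2).re)
    (M := fun y => 2 * q y * ((μ : ℂ) ^ 2).im)
    (K := fun y => 2 * r y - 2 * q y * ((μ : ℂ) ^ 2).re)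
    (fun y => trace_dxx_pos (p y) (q y) (r y) μ) (fun y => trace_dxy_pos (p y) (q y) (r y) μ)
    (fun y => trace_dyy_pos (q y) (r y) μ) (fun y => ?_) (fun y => ?_)
  · field_simp; ring
  -- Here `v(L - K - 2iM)/4 = (2r/H) q (Re λ² - i Im λ²) = (2qr/H) λ⁻²`, and `qr = ab`.
  · have hI := Complex.I_mul_I
    have h1 := hqr y
    push_cast
    rw [coe_re_sq, coe_im_sq]
    generalize (q y : ℂ) = q at *
    generalize (r y : ℂ) = r at *
    rw [show 2 * (a : ℂ) * b = 2 * (q * r) by rw [h1]; ring]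
    field_simp
    linear_combination (2 * q * r * ((μ : ℂ) ^ 4 - 1)) * hI

theorem sym_dx_neg (p q r : ℝ) (μ : Circle) {H : ℝ} (hH : H ≠ 0) :
    (-(1 / (2 * H))) • (laxU p q r μ * ((-((-1) : ℝ)) • e1)
      - ((-((-1) : ℝ)) • e1) * laxU p q r μ + laxU' q r μ)
      = (2 * q * H⁻¹) • tangentA (-1) μ⁻¹ := by
  have hμ := μ.coe_ne_zero
  have hI := Complex.I_mul_I
  have hHc : (H : ℂ) ≠ 0 := Complex.ofReal_ne_zero.2 hH
  ext i j
  fin_cases i <;> fin_cases j <;> simp [laxU, laxU', e1, tangentA] <;> field_simp <;> grind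

theorem sym_dy_neg (q r : ℝ) (μ : Circle) {H : ℝ} (hH : H ≠ 0) :
    (-(1 / (2 * H))) • (laxV q r μ * ((-((-1) : ℝ)) • e1)
      - ((-((-1) : ℝ)) • e1) * laxV q r μ + laxV' q r μ)
      = (2 * q * H⁻¹) • tangentB μ⁻¹ := by
  have hμ := μ.coe_ne_zero
  have hI := Complex.I_mul_I
  have hHc : (H : ℂ) ≠ 0 := Complex.ofReal_ne_zero.2 hH
  ext i j
  fin_cases i <;> fin_cases j <;> simp [laxV, laxV', e1, tangentB] <;> field_simp <;> grind

theorem trace_dxx_neg (p q r : ℝ) (μ : Circle) :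
    -2 * ((laxU p q r μ * tangentA (-1) μ⁻¹
      - tangentA (-1) μ⁻¹ * laxU p q r μ) * ((-((-1) : ℝ)) • e1)).trace
      = ((2 * q + 2 * r * ((μ : ℂ) ^ 2).re : ℝ) : ℂ) := by
  have hμ := μ.coe_ne_zero
  have hI := Complex.I_mul_I
  push_cast
  rw [coe_re_sq]
  simp [Matrix.trace_fin_two, laxU, tangentA, e1]
  field_simp
  grind

theorem trace_dxy_neg (p q r : ℝ) (μ : Circle) :
    -2 * ((laxU p q r μ * tangentB μ⁻¹
      - tangentB μ⁻¹ * laxU p q r μ) * ((-((-1) : ℝ)) • e1)).trace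
      = ((2 * r * ((μ : ℂ) ^ 2).im : ℝ) : ℂ) := by
  have hμ := μ.coe_ne_zero
  have hI := Complex.I_mul_I
  push_cast
  rw [coe_im_sq]
  simp [Matrix.trace_fin_two, laxU, tangentB, e1]
  field_simp
  grind

theorem trace_dyy_neg (q r : ℝ) (μ : Circle) :
    -2 * ((laxV q r μ * tangentB μ⁻¹
      - tangentB μ⁻¹ * laxV q r μ) * ((-((-1) : ℝ)) • e1)).trace
      = ((2 * q - 2 * r * ((μ : ℂ) ^ 2).re : ℝ) : ℂ) := by
  have hμ := μ.coe_ne_zero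
  have hI := Complex.I_mul_I
  push_cast
  rw [coe_re_sq]
  simp [Matrix.trace_fin_two, laxV, tangentB, e1]
  field_simp
  grind

/-- The parallel surface `f⁻`. -/
theorem hasSurfaceInvariants_symBobenko_neg (hF : IsExtendedFrame (normalForm a b) F)
    (h : IsLaxSolution a b p q r) (μ : Circle) {H : ℝ} (hH : H ≠ 0) (hq : ∀ y, q y ≠ 0) :
    HasSurfaceInvariants (symBobenko H (-1) F μ) (fun z => 2 * q z.im * H⁻¹) H
      (((μ : ℂ) ^ 2)⁻¹ * ((2 * a * b * H⁻¹ : ℝ) : ℂ)) := by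
  have hμ := μ.coe_ne_zero
  have hHc : (H : ℂ) ≠ 0 := Complex.ofReal_ne_zero.2 hH
  have hv : ∀ y, HasDerivAt (fun y => 2 * q y * H⁻¹) (2 * (-2 * p y * q y) * H⁻¹) y :=
    fun y => ((h.hasDerivAt_q y).const_mul 2).mul_const _
  have hvs : ContDiff ℝ ∞ fun y => 2 * q y * H⁻¹ :=
    (contDiff_const.mul h.contDiff.2.1).mul contDiff_const
  have hv0 : ∀ y, 2 * q y * H⁻¹ ≠ 0 := fun y =>
    mul_ne_zero (mul_ne_zero two_ne_zero (hq y)) (inv_ne_zero hH)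
  have hd := hF.hasFDerivAt_symBobenko h μ H (-1)
    (X := fun y => (2 * q y * H⁻¹) • tangentA (-1) μ⁻¹)
    (Y := fun y => (2 * q y * H⁻¹) • tangentB μ⁻¹)
    (fun y => sym_dx_neg (p y) (q y) (r y) μ hH) (fun y => sym_dy_neg (q y) (r y) μ hH)
  have hqr : ∀ y, (q y : ℂ) * r y = a * b := fun y => by exact_mod_cast h.mul_eq y
  refine hasSurfaceInvariants_of_isFrame (hF.isFrame h μ) hv hvs hv0 (isSu2_tangentA (-1) μ⁻¹)
    (isSu2_tangentB μ⁻¹) (tangent_commutator (-1) μ⁻¹) (trace_tangentA_mul_self (by norm_num) _)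
    (trace_tangentB_mul_self _) (trace_tangentA_mul_tangentB _ _) hd
    (L := fun y => 2 * q y + 2 * r y * ((μ : ℂ) ^ 2).re)
    (M := fun y => 2 * r y * ((μ : ℂ) ^ 2).im)
    (K := fun y => 2 * q y - 2 * r y * ((μ : ℂ) ^ 2).re)
    (fun y => trace_dxx_neg (p y) (q y) (r y) μ) (fun y => trace_dxy_neg (p y) (q y) (r y) μ)
    (fun y => trace_dyy_neg (q y) (r y) μ) (fun y => ?_) (fun y => ?_)
  · field_simp; ring
  · have hI := Complex.I_mul_I
    have h1 := hqr y
    push_cast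
    rw [coe_re_sq, coe_im_sq]
    generalize (q y : ℂ) = q at *
    generalize (r y : ℂ) = r at *
    rw [show 2 * (a : ℂ) * b = 2 * (q * r) by rw [h1]; ring]
    field_simp
    linear_combination (2 * q * r * ((μ : ℂ) ^ 4 - 1)) * hI

end SymBobenko

/-! ### The Jacobi amplitude and the explicit Lax solution -/

section Jacobi

open Real

/-- Near an amplitude in the domain, `ellipticF` has the expected derivative. -/
theorem hasDerivAt_ellipticF {m φ : ℝ} (h : φ ∈ amplitudeDomain m) :
    HasDerivAt (ellipticF m) (1 / √(1 - m * sin φ ^ 2)) φ := by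
  have hmem : ∀ θ ∈ Set.uIcc 0 φ, √(1 - m * sin θ ^ 2) ≠ 0 := fun θ hθ =>
    (Real.sqrt_pos.2 (sub_pos.2 (h θ hθ))).ne'
  have hcont : ∀ θ ∈ Set.uIcc 0 φ, ContinuousAt (fun θ => 1 / √(1 - m * sin θ ^ 2)) θ :=
    fun θ hθ => ContinuousAt.div (by fun_prop) (by fun_prop) (hmem θ hθ)
  refine intervalIntegral.integral_hasDerivAt_right
    (ContinuousOn.intervalIntegrable fun θ hθ => (hcont θ hθ).continuousWithinAt) ?_
    (hcont φ Set.right_mem_uIcc)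
  exact (Measurable.stronglyMeasurable (by fun_prop)).stronglyMeasurableAtFilter

theorem ordConnected_amplitudeDomain (m : ℝ) : (amplitudeDomain m).OrdConnected := by
  refine ⟨fun x hx y hy z hz θ hθ => ?_⟩
  rcases le_total 0 z with h | h
  · refine hy θ ?_
    rw [Set.uIcc_of_le h] at hθ
    rw [Set.uIcc_of_le (h.trans hz.2)]
    exact ⟨hθ.1, hθ.2.trans hz.2⟩
  · refine hx θ ?_
    rw [Set.uIcc_of_ge h] at hθ
    rw [Set.uIcc_of_ge (hz.1.trans h)]
    exact ⟨hz.1.trans hθ.1, hθ.2⟩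

theorem strictMonoOn_ellipticF (m : ℝ) : StrictMonoOn (ellipticF m) (amplitudeDomain m) := by
  have hconv : Convex ℝ (amplitudeDomain m) := (ordConnected_amplitudeDomain m).convex
  refine strictMonoOn_of_deriv_pos hconv
    (fun φ hφ => (hasDerivAt_ellipticF hφ).continuousAt.continuousWithinAt) fun φ hφ => ?_
  have hφ' := interior_subset hφ
  rw [(hasDerivAt_ellipticF hφ').deriv]
  have := hφ' φ Set.right_mem_uIcc
  exact one_div_pos.2 (Real.sqrt_pos.2 (sub_pos.2 this))

/-- A solution `φ` of `φ' = √(1 - m sin² φ)`, `φ(0) = 0` is the Jacobi amplitude. -/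
theorem jacobiAm_eq_of_hasDerivAt {m : ℝ} {φ : ℝ → ℝ} (h0 : φ 0 = 0)
    (hmem : ∀ u, φ u ∈ amplitudeDomain m)
    (hφ : ∀ u, HasDerivAt φ (√(1 - m * sin (φ u) ^ 2)) u) (u : ℝ) : jacobiAm u m = φ u := by
  have hd : ∀ u, HasDerivAt (fun u => ellipticF m (φ u) - u) 0 u := by
    intro u
    have hpos := Real.sqrt_pos.2 (sub_pos.2 (hmem u (φ u) Set.right_mem_uIcc))
    -- The integrand of `ellipticF` is the reciprocal of the right side of the equation for `φ`.
    refine (((hasDerivAt_ellipticF (hmem u)).comp u (hφ u)).sub (hasDerivAt_id u)).congr_deriv ?_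
    field_simp
    simp
  have hF : ∀ u, ellipticF m (φ u) = u := by
    intro u
    have := is_const_of_deriv_eq_zero (fun y => (hd y).differentiableAt) (fun y => (hd y).deriv)
      u 0
    simp only [h0, sub_zero] at this
    have h00 : ellipticF m 0 = 0 := by simp [ellipticF]
    linarith
  have hex : ∃ φ ∈ amplitudeDomain m, ellipticF m φ = u := ⟨φ u, hmem u, hF u⟩
  refine (strictMonoOn_ellipticF m).injOn (Function.invFunOn_mem hex) (hmem u) ?_
  rw [hF]
  exact Function.invFunOn_eq hex

theorem mul_sin_sq_lt_one {m : ℝ} (hm : m < 1) (θ : ℝ) : m * sin θ ^ 2 < 1 := by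
  rcases le_total m 0 with h | h
  · nlinarith [sq_nonneg (sin θ)]
  · nlinarith [sin_sq_le_one θ]

/-- The amplitude for `m < 1`. -/
theorem exists_amplitude_of_lt {m : ℝ} (hm : m < 1) :
    ∃ φ : ℝ → ℝ, φ 0 = 0 ∧ (∀ u, φ u ∈ amplitudeDomain m) ∧
      ∀ u, HasDerivAt φ (√(1 - m * sin (φ u) ^ 2)) u := by
  have hdom : ∀ φ, φ ∈ amplitudeDomain m := fun φ θ _ => mul_sin_sq_lt_one hm θ
  have hpos : ∀ θ, 0 < √(1 - m * sin θ ^ 2) := fun θ =>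
    Real.sqrt_pos.2 (sub_pos.2 (mul_sin_sq_lt_one hm θ))
  have hd : ∀ φ, HasDerivAt (ellipticF m) (1 / √(1 - m * sin φ ^ 2)) φ := fun φ =>
    hasDerivAt_ellipticF (hdom φ)
  have hmono : StrictMono (ellipticF m) := fun x y hxy =>
    strictMonoOn_ellipticF m (hdom x) (hdom y) hxy
  have hcont : Continuous (ellipticF m) :=
    continuous_iff_continuousAt.2 fun φ => (hd φ).continuousAt
  have h00 : ellipticF m 0 = 0 := by simp [ellipticF]
  -- Since `1 - m sin² θ ≤ 1 + |m|`, the slope of `ellipticF` is at least `1/k`; this linear growth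
  -- gives surjectivity, also for negative `m`.
  set k : ℝ := √(1 + |m|) with hk
  have hk0 : 0 < k := Real.sqrt_pos.2 (by positivity)
  have hle : ∀ θ, 1 / k ≤ 1 / √(1 - m * sin θ ^ 2) := by
    intro θ
    refine one_div_le_one_div_of_le (hpos θ) (Real.sqrt_le_sqrt ?_)
    have h1 : |m * sin θ ^ 2| ≤ |m| * 1 := by
      rw [abs_mul, abs_of_nonneg (sq_nonneg (sin θ))]
      exact mul_le_mul_of_nonneg_left (sin_sq_le_one θ) (abs_nonneg m)
    linarith [neg_abs_le (m * sin θ ^ 2)]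
  have hmon2 : Monotone fun φ => ellipticF m φ - 1 / k * φ := by
    have hd2 : ∀ φ, HasDerivAt (fun φ => ellipticF m φ - 1 / k * φ)
        (1 / √(1 - m * sin φ ^ 2) - 1 / k) φ := fun φ =>
      ((hd φ).fun_sub ((hasDerivAt_id φ).const_mul (1 / k))).congr_deriv (by simp)
    refine monotone_of_deriv_nonneg (fun φ => (hd2 φ).differentiableAt) fun φ => ?_
    rw [(hd2 φ).deriv]
    linarith [hle φ]
  have hsurj : Function.Surjective (ellipticF m) := by
    refine hcont.surjective ?_ ?_
    · refine Filter.tendsto_atTop_mono' _ ?_ (Filter.tendsto_id.const_mul_atTop (one_div_pos.2 hk0))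
      filter_upwards [Filter.eventually_ge_atTop 0] with φ hφ
      have := hmon2 hφ
      simp only [h00, mul_zero, sub_zero] at this
      simp only [id]; linarith
    · refine Filter.tendsto_atBot_mono' _ ?_ (Filter.tendsto_id.const_mul_atBot (one_div_pos.2 hk0))
      filter_upwards [Filter.eventually_le_atBot 0] with φ hφ
      have := hmon2 hφ
      simp only [h00, mul_zero, sub_zero] at this
      simp only [id]; linarith
  set e := hmono.orderIsoOfSurjective _ hsurj with he
  have hinv : ∀ u, ellipticF m (e.symm u) = u := fun u => e.apply_symm_apply u
  refine ⟨e.symm, hmono.injective (by rw [hinv, h00]), fun u => hdom _, fun u => ?_⟩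
  have := (hd (e.symm u)).of_local_left_inverse e.symm.continuous.continuousAt
    (one_div_pos.2 (hpos _)).ne' (Filter.Eventually.of_forall hinv)
  simpa using this

/-- The amplitude for `m = 1` is the Gudermannian function. -/
theorem exists_amplitude_one :
    ∃ φ : ℝ → ℝ, φ 0 = 0 ∧ (∀ u, φ u ∈ amplitudeDomain 1) ∧
      ∀ u, HasDerivAt φ (√(1 - 1 * sin (φ u) ^ 2)) u := by
  refine ⟨fun u => arctan (sinh u), by simp, fun u θ hθ => ?_, fun u => ?_⟩
  · have h1 := arctan_lt_pi_div_two (sinh u)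
    have h2 := neg_pi_div_two_lt_arctan (sinh u)
    have hθ' : θ ∈ Set.Ioo (-(π / 2)) (π / 2) := by
      have := pi_pos
      rw [Set.mem_uIcc] at hθ
      constructor <;> rcases hθ with h | h <;> linarith [h.1, h.2]
    have := cos_pos_of_mem_Ioo hθ'
    nlinarith [sin_sq_add_cos_sq θ, pow_pos this 2]
  · refine ((hasDerivAt_sinh u).arctan).congr_deriv ?_
    have hc := cosh_pos u
    have hs : 1 + sinh u ^ 2 = cosh u ^ 2 := by rw [cosh_sq]; ring
    rw [one_mul, ← cos_sq', Real.sqrt_sq (cos_arctan_pos _).le, cos_arctan, hs,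
      Real.sqrt_sq hc.le]
    field_simp

/-- The Jacobi amplitude satisfies `am' = dn > 0`. -/
theorem jacobiAm_spec {m : ℝ} (hm : m ≤ 1) :
    jacobiAm 0 m = 0 ∧ ∀ u, m * sin (jacobiAm u m) ^ 2 < 1 ∧
      HasDerivAt (fun u => jacobiAm u m) (jacobiDn u m) u := by
  obtain ⟨φ, h0, hmem, hφ⟩ : ∃ φ : ℝ → ℝ, φ 0 = 0 ∧ (∀ u, φ u ∈ amplitudeDomain m) ∧
      ∀ u, HasDerivAt φ (√(1 - m * sin (φ u) ^ 2)) u := by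
    rcases hm.lt_or_eq with h | rfl
    · exact exists_amplitude_of_lt h
    · exact exists_amplitude_one
  have hEq : ∀ u, jacobiAm u m = φ u := jacobiAm_eq_of_hasDerivAt h0 hmem hφ
  simp only [jacobiDn, hEq]
  exact ⟨h0, fun u => ⟨hmem u _ Set.right_mem_uIcc, hφ u⟩⟩

/-- The solution of the Lax system in terms of the Jacobi elliptic function `dn`. -/
theorem exists_isLaxSolution (a : ℝ) {b : ℝ} (hb : b ≠ 0) :
    ∃ p q : ℝ → ℝ, IsLaxSolution a b p q
        (fun y => b * jacobiDn (2 * b * y) (1 - a ^ 2 / b ^ 2)) ∧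
      ∀ y, b * jacobiDn (2 * b * y) (1 - a ^ 2 / b ^ 2) ≠ 0 := by
  set m := 1 - a ^ 2 / b ^ 2 with hmdef
  have hm : m ≤ 1 := by have : 0 ≤ a ^ 2 / b ^ 2 := by positivity
                        linarith
  have hmb : b ^ 2 * m = b ^ 2 - a ^ 2 := by rw [hmdef]; field_simp
  obtain ⟨h0, hspec⟩ := jacobiAm_spec hm
  set φ : ℝ → ℝ := fun y => jacobiAm (2 * b * y) m with hφdef
  set r : ℝ → ℝ := fun y => b * jacobiDn (2 * b * y) m with hrdef
  have hφ0 : φ 0 = 0 := by simp [hφdef, h0]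
  have hlt : ∀ y, 0 < 1 - m * sin (φ y) ^ 2 := fun y => sub_pos.2 (hspec (2 * b * y)).1
  have hφ : ∀ y, HasDerivAt φ (2 * r y) y := by
    intro y
    have h1 : HasDerivAt (fun y : ℝ => 2 * b * y) (2 * b) y := by
      simpa using (hasDerivAt_id y).const_mul (2 * b)
    refine ((hspec (2 * b * y)).2.comp y h1).congr_deriv ?_
    simp only [hrdef]; ring
  have hreq : ∀ y, r y = b * √(1 - m * sin (φ y) ^ 2) := fun y => rfl
  have hr0 : ∀ y, r y ≠ 0 := fun y => mul_ne_zero hb (Real.sqrt_pos.2 (hlt y)).ne'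
  have hrsq : ∀ y, r y ^ 2 = b ^ 2 - (b ^ 2 - a ^ 2) * sin (φ y) ^ 2 := by
    intro y
    rw [hreq, mul_pow, Real.sq_sqrt (hlt y).le, ← hmb]; ring
  have hsin : ∀ y, HasDerivAt (fun y => sin (φ y)) (cos (φ y) * (2 * r y)) y := fun y =>
    (hφ y).sin
  have hcos : ∀ y, HasDerivAt (fun y => cos (φ y)) (-sin (φ y) * (2 * r y)) y := fun y =>
    (hφ y).cos
  have hr : ∀ y, HasDerivAt r (-(2 * (b ^ 2 - a ^ 2) * sin (φ y) * cos (φ y))) y := by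
    intro y
    have h1 : HasDerivAt (fun y => 1 - m * sin (φ y) ^ 2)
        (-(m * (2 * sin (φ y) * (cos (φ y) * (2 * r y))))) y := by
      refine ((((hsin y).fun_pow 2).const_mul m).const_sub 1).congr_deriv ?_
      simp
    refine ((h1.sqrt (hlt y).ne').const_mul b).congr_deriv ?_
    have h2 := (Real.sqrt_pos.2 (hlt y)).ne'
    rw [hreq]
    field_simp
    rw [← hmb]
    ring
  -- Both witnesses are forced by `r`: `p = r'/(2r)` from the third equation, and `q = ab/r` from
  -- the conserved product.
  refine ⟨fun y => -((b ^ 2 - a ^ 2) * sin (φ y) * cos (φ y)) / r y, fun y => a * b / r y,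
    ⟨fun y => ?_, fun y => ?_, fun y => ?_, ?_, ?_, ?_⟩, hr0⟩
  · have hy := hr0 y
    refine (((((hsin y).const_mul (b ^ 2 - a ^ 2)).fun_mul (hcos y)).fun_neg).fun_div (hr y)
      hy).congr_deriv ?_
    have h1 := hrsq y
    field_simp
    rw [show r y ^ 4 = (r y ^ 2) ^ 2 by ring, h1, cos_sq']
    ring
  · have hy := hr0 y
    refine ((hasDerivAt_const y (a * b)).fun_div (hr y) hy).congr_deriv ?_
    field_simp
    ring
  · have hy := hr0 y
    refine (hr y).congr_deriv ?_
    field_simp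
  · simp [hφ0]
  · rw [hreq, hφ0]; simp; field_simp
  · rw [hreq, hφ0]; simp

theorem IsLaxSolution.swap {a b : ℝ} {p q r : ℝ → ℝ} (h : IsLaxSolution a b p q r) :
    IsLaxSolution b a (fun y => -p y) r q where
  hasDerivAt_p y := (h.hasDerivAt_p y).fun_neg.congr_deriv (by ring)
  hasDerivAt_q y := (h.hasDerivAt_r y).congr_deriv (by ring)
  hasDerivAt_r y := (h.hasDerivAt_q y).congr_deriv (by ring)
  p_zero := by simp [h.p_zero]
  q_zero := h.r_zero
  r_zero := h.q_zero

end Jacobi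
end EquivariantCMC
end

/-! ### Both surfaces from the `dn` solution -/

theorem mainTheorem7 (a b H : ℝ) (hH : H ≠ 0) (F : ℂ → EquivariantCMC.MatLoop)
    (hF : EquivariantCMC.IsExtendedFrame (EquivariantCMC.normalForm a b) F) (μ : Circle) :
    (b ≠ 0 →
      EquivariantCMC.HasSurfaceInvariants (EquivariantCMC.symBobenko H 1 F μ)
        (fun z => EquivariantCMC.v0 a b H z.im) H
        (((μ : ℂ) ^ 2)⁻¹ * ((2 * a * b * H⁻¹ : ℝ) : ℂ))) ∧
    (a ≠ 0 →
      EquivariantCMC.HasSurfaceInvariants (EquivariantCMC.symBobenko H (-1) F μ)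
        (fun z => EquivariantCMC.v0 b a H z.im) H
        (((μ : ℂ) ^ 2)⁻¹ * ((2 * a * b * H⁻¹ : ℝ) : ℂ))) := by
  refine ⟨fun hb => ?_, fun ha => ?_⟩
  · obtain ⟨p, q, h, hr⟩ := EquivariantCMC.exists_isLaxSolution a hb
    convert EquivariantCMC.hasSurfaceInvariants_symBobenko_pos hF h μ hH hr using 1
    funext z
    rw [EquivariantCMC.v0]
    ring
  -- The solution is built for `(b, a)`, where `dn` sits in the third slot; `IsLaxSolution.swap`
  -- moves it to the second slot for `(a, b)`, the one governing `f⁻`. This needs only `a ≠ 0`.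
  · obtain ⟨p, q, h, hr⟩ := EquivariantCMC.exists_isLaxSolution b ha
    convert EquivariantCMC.hasSurfaceInvariants_symBobenko_neg hF h.swap μ hH hr using 1
    funext z
    rw [EquivariantCMC.v0]
    ring
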